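/- **Model.** Let $n,t$ be integers with $0\le t$ and $3t<n$. There are $n$ processes, a fixed set of at most $t$ of which is faulty (Byzantine); the others are non-faulty. Communication is asynchronous and point-to-point. Every message sent by a non-faulty process to a non-faulty process is received after a finite but unbounded delay. The receiver knows the sender, and messages of non-faulty processes are neither forged nor altered. Faulty processes may send arbitrary messages at any time. Every non-faulty process that can take a step eventually does so. Let $d\ge 2$ be a constant. For every round $r$ there is a weak common coin, which a process obtains by calling $\mathsf{random}()$ in round $r$. With probability $1/d$ it outputs $0$ at all non-faulty processes, with probability $1/d$ it outputs $1$ at all non-faulty processes, and with probability $(d-2)/d$ it outputs different values at non-faulty processes. These probabilities hold conditionally on everything that happens before the first call of $\mathsf{random}()$ in round $r$ by a non-faulty process, and only after that call is the coin of round $r$ revealed. The order of the events, the messages of the faulty processes and all nondeterministic choices are controlled by an adaptive, possibly randomized adversary who sees everything except the coins not yet revealed. The conditions on finite delays and on steps being eventually taken are required to hold almost surely. **Algorithm.** ("Broadcast" means sending the message to all $n$ processes.) Values are $0$, $1$ and $\bot$. *SBV-Broadcast with tag $\tau$ and input $v$:* set $\mathit{bin}_\tau\leftarrow\emptyset$ and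 broadcast $\mathrm{BVAL}_\tau(v)$; wait until $\mathit{bin}_\tau\ne\emptyset$; broadcast $\mathrm{AUX}_\tau(w)$ for some $w\in\mathit{bin}_\tau$; wait until there is a set $V$ whose elements belong to $\mathit{bin}_\tau$ and are the values of $\mathrm{AUX}_\tau$ messages received from $n-t$ distinct processes; return $(V,\mathit{bin}_\tau)$. From the invocation on, and also after it has returned, whenever $\mathrm{BVAL}_\tau(x)$ has been received from $t+1$ different processes and has not been broadcast yet, the process broadcasts $\mathrm{BVAL}_\tau(x)$; whenever $\mathrm{BVAL}_\tau(x)$ has been received from $2t+1$ different processes, it adds $x$ to $\mathit{bin}_\tau$. (So $\mathit{bin}_\tau$ may still grow after it has been returned.) *Consensus:* each non-faulty process proposes a value in $\{0,1\}$, sets $\mathit{est}$ to its proposal, and repeats the following for $r=1,2,3,\dots$ 1. $(\mathit{view}_0,\mathit{bin})\leftarrow$ SBV-Broadcast with tag $(r,0)$ and input $\mathit{est}$. 2. Broadcast $\mathrm{AUXSET}_r(\mathit{view}_0)$. 3. Wait until there is a set $\mathit{view}_1$ that is the union of the sets carried by $\mathrm{AUXSET}_r$ messages received from $n-t$ distinct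 processes, all of these sets being contained in $\mathit{bin}$. 4. If $\mathit{view}_1=\{w\}$ then $\mathit{est}\leftarrow w$, else $\mathit{est}\leftarrow\bot$. 5. $(\mathit{view}_2,\cdot)\leftarrow$ SBV-Broadcast with tag $(r,1)$ and input $\mathit{est}$. 6. $s\leftarrow\mathsf{random}()$. 7. If $\mathit{view}_2=\{v\}$ with $v\neq\bot$, then $\mathit{est}\leftarrow v$ and decide $v$ (if no decision was made before); if $\mathit{view}_2=\{v,\bot\}$ with $v\ne\bot$, then $\mathit{est}\leftarrow v$; if $\mathit{view}_2=\{\bot\}$, then $\mathit{est}\leftarrow s$. **Theorem.** This algorithm solves binary Byzantine consensus: * (BBC-Termination) with probability $1$, every non-faulty process eventually decides on a value; * (BBC-Agreement) no two non-faulty processes decide on different values; * (BBC-Validity) if all non-faulty processes propose the same value, no non-faulty process decides another value. Agreement and validity hold in every execution. Moreover, the first round by the end of which all non-faulty processes have decided has expectation at most $d+1$. -/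

import Mathlib

open MeasureTheory
open scoped ENNReal

namespace BBC

/-! ## Messages and local states -/

/-- Values handled by the broadcast abstractions: `some b` is the binary value `b`
(`false` is `0`, `true` is `1`) and `none` is `⊥`. -/
abbrev Val := Option Bool

/-- The tag `STAGE[r, s]` of an instance of SBV-Broadcast: a round number and `s ∈ {0, 1}`. -/
abbrev Tag := ℕ × Fin 2

/-- The messages of the protocol.  Every message of a non-faulty process is broadcast. -/
inductive Msg where
  /-- message `BVAL(v)` of the BV-Broadcast instance with the given tag -/
  | bval (tag : Tag) (v : Val)
  /-- message `AUX(w)` of the SBV-Broadcast instance with the given tag -/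
  | aux (tag : Tag) (w : Val)
  /-- message `AUXSET[r](s)` -/
  | auxset (r : ℕ) (s : Set Val)

/-- Control points of the main thread of a process. -/
inductive PC where
  /-- top of the loop: increment the round, then invoke `SBV_broadcast STAGE[r,0](est)` -/
  | roundStart
  /-- inside SBV-Broadcast: wait for `bin_values ≠ ∅`, then broadcast `AUX(w)` -/
  | sbvAux (s : Fin 2)
  /-- inside SBV-Broadcast: wait for a set `view`, then return it -/
  | sbvReturn (s : Fin 2)
  /-- broadcast `AUXSET[r](view[r,0])` -/
  | sendAuxset
  /-- wait for a set `view[r,1]` -/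
  | waitAuxset
  /-- set the estimate from `view[r,1]` -/
  | setEst
  /-- invoke `SBV_broadcast STAGE[r,1](est)` -/
  | secondSbv
  /-- `s ← random()` -/
  | callRandom
  /-- the final case distinction of the round -/
  | finalCase

/-- The local state of a process in a system of `n` processes. -/
structure LocalState (n : ℕ) where
  pc : PC
  /-- current round `r` -/
  round : ℕ
  /-- current estimate `est` -/
  est : Val
  /-- variable `s`: last value returned by `random()` -/
  coinVal : Bool
  /-- the map `view[r, 0 .. 2]` -/
  view : ℕ × Fin 3 → Set Val
  /-- the set `bin_values` of every BV-Broadcast instance; `bin_values[r]` of the consensus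
  algorithm is the one of the instance `STAGE[r,0]` -/
  bin : Tag → Set Val
  /-- the (S)BV-Broadcast instances that this process has invoked -/
  started : Set Tag
  /-- the messages that this process has broadcast -/
  sent : Set Msg
  /-- the pairs (sender, message) that this process has received -/
  rcvd : Set (Fin n × Msg)
  /-- the rounds in which this process has called `random()` -/
  coinCalls : Set ℕ
  /-- the round in which this process has decided and the decided value, if any -/
  decision : Option (ℕ × Bool)

variable {n : ℕ}

/-- The state of a process at the beginning of `propose(v)` (`est ← v; r ← 0`). -/
def LocalState.init (n : ℕ) (v : Bool) : LocalState n where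
  pc := .roundStart
  round := 0
  est := some v
  coinVal := false
  view := fun _ => ∅
  bin := fun _ => ∅
  started := ∅
  sent := ∅
  rcvd := ∅
  coinCalls := ∅
  decision := none

/-- `m` has been received from at least `q` different processes. -/
def LocalState.ReceivedFrom (l : LocalState n) (m : Msg) (q : ℕ) : Prop :=
  ∃ Q : Finset (Fin n), q ≤ Q.card ∧ ∀ j ∈ Q, (j, m) ∈ l.rcvd

/-- Broadcasting a message. -/
def LocalState.broadcast (l : LocalState n) (m : Msg) : LocalState n :=
  { l with sent := insert m l.sent }

/-- Invocation of (S)BV-Broadcast with tag `τ` and input `v`: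
`bin_values ← ∅; broadcast BVAL(v)`. -/
def LocalState.invoke (l : LocalState n) (τ : Tag) (v : Val) : LocalState n :=
  { l with
    bin := Function.update l.bin τ ∅
    started := insert τ l.started
    sent := insert (Msg.bval τ v) l.sent }

/-- `V` is a possible result of the wait statement of SBV-Broadcast: its values belong to
`bin_values` and are those of `AUX` messages received from (at least) `n - t` distinct processes. -/
def LocalState.AuxView (t : ℕ) (l : LocalState n) (τ : Tag) (V : Set Val) : Prop :=
  ∃ (Q : Finset (Fin n)) (w : Fin n → Val), n - t ≤ Q.card ∧
    (∀ j ∈ Q, (j, Msg.aux τ (w j)) ∈ l.rcvd ∧ w j ∈ l.bin τ) ∧ V = {x | ∃ j ∈ Q, w j = x}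

/-- `V` is a possible result of the wait statement on `AUXSET[r]` messages: its values belong to
`bin_values[r]` and are those of `AUXSET[r]` messages received from (at least) `n - t` distinct
processes. -/
def LocalState.AuxsetView (t : ℕ) (l : LocalState n) (r : ℕ) (V : Set Val) : Prop :=
  ∃ (Q : Finset (Fin n)) (S : Fin n → Set Val), n - t ≤ Q.card ∧
    (∀ j ∈ Q, (j, Msg.auxset r (S j)) ∈ l.rcvd ∧ S j ⊆ l.bin (r, 0)) ∧ V = {x | ∃ j ∈ Q, x ∈ S j}

/-! ## The algorithm -/

/-- The threads of a process: the code of `propose`, and the two statements of the reception handler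
of BV-Broadcast, for every instance and value. -/
inductive Thread where
  | main
  | bvEcho (τ : Tag) (v : Val)
  | bvDeliver (τ : Tag) (v : Val)

/-- The position in `view[r, ·]` of the set returned by `SBV_broadcast STAGE[r,s]`. -/
def viewIndex (s : Fin 2) : Fin 3 := if s = 0 then 0 else 2

/-- The control point after the return of `SBV_broadcast STAGE[r,s]`. -/
def afterSbv (s : Fin 2) : PC := if s = 0 then .sendAuxset else .callRandom

/-- The steps of a non-faulty process.  `coin r` is the value that `random()` returns to the process
in round `r`; `t` is the resilience parameter. -/
inductive ThreadStep (t : ℕ) (coin : ℕ → Bool) :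
    Thread → LocalState n → LocalState n → Prop
  /-- `r ← r + 1`, then invocation of `SBV_broadcast STAGE[r,0](est)` -/
  | roundStart (l : LocalState n) : l.pc = .roundStart →
      ThreadStep t coin .main l
        { l.invoke (l.round + 1, 0) l.est with round := l.round + 1, pc := .sbvAux 0 }
  /-- `wait (bin_values ≠ ∅); broadcast AUX(w)` where `w ∈ bin_values` -/
  | sbvAux (l : LocalState n) (s : Fin 2) (w : Val) : l.pc = .sbvAux s →
      w ∈ l.bin (l.round, s) →
      ThreadStep t coin .main l
        { l.broadcast (.aux (l.round, s) w) with pc := .sbvReturn s }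
  /-- `wait (∃ view ...); return view` -/
  | sbvReturn (l : LocalState n) (s : Fin 2) (V : Set Val) : l.pc = .sbvReturn s →
      l.AuxView t (l.round, s) V →
      ThreadStep t coin .main l
        { l with view := Function.update l.view (l.round, viewIndex s) V, pc := afterSbv s }
  /-- `broadcast AUXSET[r](view[r,0])` -/
  | sendAuxset (l : LocalState n) : l.pc = .sendAuxset →
      ThreadStep t coin .main l
        { l.broadcast (.auxset l.round (l.view (l.round, 0))) with pc := .waitAuxset }
  /-- `wait (∃ view[r,1] ...)` -/
  | waitAuxset (l : LocalState n) (V : Set Val) : l.pc = .waitAuxset →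
      l.AuxsetView t l.round V →
      ThreadStep t coin .main l
        { l with view := Function.update l.view (l.round, 1) V, pc := .setEst }
  /-- `view[r,1] = {w}`: `est ← w` -/
  | setEstSingle (l : LocalState n) (w : Val) : l.pc = .setEst →
      l.view (l.round, 1) = {w} →
      ThreadStep t coin .main l { l with est := w, pc := .secondSbv }
  /-- otherwise: `est ← ⊥` -/
  | setEstBot (l : LocalState n) : l.pc = .setEst →
      (∀ w, l.view (l.round, 1) ≠ {w}) →
      ThreadStep t coin .main l { l with est := none, pc := .secondSbv }
  /-- invocation of `SBV_broadcast STAGE[r,1](est)` -/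
  | secondSbv (l : LocalState n) : l.pc = .secondSbv →
      ThreadStep t coin .main l { l.invoke (l.round, 1) l.est with pc := .sbvAux 1 }
  /-- `s ← random()` -/
  | callRandom (l : LocalState n) : l.pc = .callRandom →
      ThreadStep t coin .main l
        { l with
          coinVal := coin l.round
          coinCalls := insert l.round l.coinCalls
          pc := .finalCase }
  /-- `view[r,2] = {v}` with `v ≠ ⊥`: `est ← v; decide(v)` if not yet done -/
  | caseDecide (l : LocalState n) (v : Bool) : l.pc = .finalCase →
      l.view (l.round, 2) = {some v} →
      ThreadStep t coin .main l
        { l with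
          est := some v
          decision := l.decision.or (some (l.round, v))
          pc := .roundStart }
  /-- `view[r,2] = {v, ⊥}`: `est ← v` -/
  | caseAdopt (l : LocalState n) (v : Bool) : l.pc = .finalCase →
      l.view (l.round, 2) = {some v, none} →
      ThreadStep t coin .main l { l with est := some v, pc := .roundStart }
  /-- `view[r,2] = {⊥}`: `est ← s` -/
  | caseCoin (l : LocalState n) : l.pc = .finalCase →
      l.view (l.round, 2) = {none} →
      ThreadStep t coin .main l { l with est := some l.coinVal, pc := .roundStart }
  /-- no case applies: nothing is done -/
  | caseNone (l : LocalState n) : l.pc = .finalCase →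
      (∀ v : Bool, l.view (l.round, 2) ≠ {some v}) →
      (∀ v : Bool, l.view (l.round, 2) ≠ {some v, none}) →
      l.view (l.round, 2) ≠ {none} →
      ThreadStep t coin .main l { l with pc := .roundStart }
  /-- `BVAL(v)` received from `t + 1` different processes and not yet broadcast: broadcast it -/
  | bvEcho (l : LocalState n) (τ : Tag) (v : Val) : τ ∈ l.started →
      l.ReceivedFrom (.bval τ v) (t + 1) → Msg.bval τ v ∉ l.sent →
      ThreadStep t coin (.bvEcho τ v) l (l.broadcast (.bval τ v))
  /-- `BVAL(v)` received from `2 t + 1` different processes: add `v` to `bin_values` -/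
  | bvDeliver (l : LocalState n) (τ : Tag) (v : Val) : τ ∈ l.started →
      l.ReceivedFrom (.bval τ v) (2 * t + 1) → v ∉ l.bin τ →
      ThreadStep t coin (.bvDeliver τ v) l
        { l with bin := Function.update l.bin τ (insert v (l.bin τ)) }

/-! ## The asynchronous Byzantine system -/

/-- A global configuration.  The components of the faulty processes carry no information. -/
abbrev Config (n : ℕ) := Fin n → LocalState n

/-- The initial configuration, for the proposals `v`. -/
def initConfig (v : Fin n → Bool) : Config n := fun i => LocalState.init n (v i)

/-- What can happen at an instant: a step of a thread of process `i`, the reception by `i` of a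
message `m` from `j`, or nothing that non-faulty processes notice. -/
inductive Action (n : ℕ) where
  | thread (i : Fin n) (th : Thread)
  | recv (i j : Fin n) (m : Msg)
  | idle

/-- Global steps, for the set `F` of faulty processes.  A message received from a non-faulty process
was broadcast by it, whereas a faulty process can send any message to any process at any time. -/
inductive Step (t : ℕ) (F : Finset (Fin n)) (coin : ℕ → Fin n → Bool) :
    Config n → Action n → Config n → Prop
  | thread (c : Config n) (i : Fin n) (th : Thread) (l : LocalState n) : i ∉ F →
      ThreadStep t (fun r => coin r i) th (c i) l →
      Step t F coin c (.thread i th) (Function.update c i l)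
  | recv (c : Config n) (i j : Fin n) (m : Msg) : i ∉ F → (j ∈ F ∨ m ∈ (c j).sent) →
      Step t F coin c (.recv i j m)
        (Function.update c i { c i with rcvd := insert (j, m) (c i).rcvd })
  | idle (c : Config n) : Step t F coin c .idle c

/-- `X` is an execution in which the actions `a` are performed successively. -/
structure IsExecution (t : ℕ) (F : Finset (Fin n)) (v : Fin n → Bool) (coin : ℕ → Fin n → Bool)
    (X : ℕ → Config n) (a : ℕ → Action n) : Prop where
  init : X 0 = initConfig v
  step : ∀ k, Step t F coin (X k) (a k) (X (k + 1))

/-- Message delays between non-faulty processes and the durations of the steps of non-faulty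
processes are finite. -/
structure IsFair (t : ℕ) (F : Finset (Fin n)) (coin : ℕ → Fin n → Bool)
    (X : ℕ → Config n) (a : ℕ → Action n) : Prop where
  /-- the network is reliable -/
  delivery : ∀ i ∉ F, ∀ j ∉ F, ∀ k m, m ∈ (X k j).sent → ∃ k', (j, m) ∈ (X k' i).rcvd
  /-- a thread of a non-faulty process that is able to take a step eventually takes one,
  unless the step ceases to be possible -/
  progress : ∀ i ∉ F, ∀ th k, (∃ c, Step t F coin (X k) (.thread i th) c) →
    ∃ k' ≥ k, a k' = .thread i th ∨ ¬ ∃ c, Step t F coin (X k') (.thread i th) c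

/-! ## The common coin -/

/-- The coin of round `r` is revealed: a non-faulty process has called `random()` in round `r`. -/
def Revealed (F : Finset (Fin n)) (r : ℕ) (c : Config n) : Prop :=
  ∃ i ∉ F, r ∈ (c i).coinCalls

/-- The event that the coin outputs `b` at all non-faulty processes in round `r`. -/
def CoinAgrees {Ω : Type*} (F : Finset (Fin n)) (coin : Ω → ℕ → Fin n → Bool) (r : ℕ) (b : Bool) :
    Set Ω :=
  {ω | ∀ i ∉ F, coin ω r i = b}

/-- `coin` is a weak common coin with parameter `d` for the random execution `X`, where `𝓕 k` is the
information available to the adversary (the scheduler and the faulty processes) at time `k`.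

Whatever the adversary has observed before the coin of round `r` is revealed, this coin outputs `0` at
all non-faulty processes with (conditional) probability `1/d`, outputs `1` at all non-faulty processes
with probability `1/d`, and hence outputs different values at non-faulty processes with probability
`(d - 2)/d`.  Once it is revealed, the adversary knows which of these three cases occurs.  In the third
case nothing is assumed about which non-faulty process obtains which value. -/
structure IsWeakCommonCoin {Ω : Type*} [MeasurableSpace Ω] (μ : Measure Ω)
    (𝓕 : Filtration ℕ (inferInstance : MeasurableSpace Ω)) (F : Finset (Fin n)) (d : ℝ)
    (coin : Ω → ℕ → Fin n → Bool) (X : ℕ → Ω → Config n) : Prop where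
  measurable : ∀ r i, Measurable fun ω => coin ω r i
  unpredictable : ∀ r b k, ∀ A : Set Ω, MeasurableSet[𝓕 k] A →
    (∀ ω ∈ A, ¬ Revealed F r (X k ω)) →
    μ.real (A ∩ CoinAgrees F coin r b) = μ.real A / d
  revealed : ∀ r b k, MeasurableSet[𝓕 k] ({ω | Revealed F r (X k ω)} ∩ CoinAgrees F coin r b)

/-- A random execution of the algorithm in the asynchronous Byzantine message-passing model with a
weak common coin: processes `Fin n`, resilience `t`, faulty processes `F`, proposals `v`, coin
parameter `d`.  The order of the events, the messages of the faulty processes and all nondeterministic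
choices are up to an adversary who may be randomized and adaptive and who observes everything
but the coins that are not yet revealed. -/
structure IsRandomExecution {Ω : Type*} [MeasurableSpace Ω] (μ : Measure Ω)
    (𝓕 : Filtration ℕ (inferInstance : MeasurableSpace Ω)) (t : ℕ) (F : Finset (Fin n))
    (v : Fin n → Bool) (d : ℝ) (coin : Ω → ℕ → Fin n → Bool)
    (X : ℕ → Ω → Config n) (a : ℕ → Ω → Action n) : Prop where
  execution : ∀ ω, IsExecution t F v (coin ω) (fun k => X k ω) (fun k => a k ω)
  fair : ∀ᵐ ω ∂μ, IsFair t F (coin ω) (fun k => X k ω) (fun k => a k ω)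
  adapted : ∀ k, ∀ S : Set (Config n), MeasurableSet[𝓕 k] (X k ⁻¹' S)
  commonCoin : IsWeakCommonCoin μ 𝓕 F d coin X

/-! ## Binary Byzantine consensus -/

/-- Process `i` decides the value `b` in the execution `X`. -/
def Decides (X : ℕ → Config n) (i : Fin n) (b : Bool) : Prop :=
  ∃ k r, (X k i).decision = some (r, b)

/-- Every non-faulty process eventually decides on a value. -/
def BBCTermination (F : Finset (Fin n)) (X : ℕ → Config n) : Prop :=
  ∀ i ∉ F, ∃ b, Decides X i b

/-- No two non-faulty processes decide on different values. -/
def BBCAgreement (F : Finset (Fin n)) (X : ℕ → Config n) : Prop :=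
  ∀ i ∉ F, ∀ j ∉ F, ∀ b b', Decides X i b → Decides X j b' → b = b'

/-- If all non-faulty processes propose the same value, no other value can be decided
(by a non-faulty process). -/
def BBCValidity (F : Finset (Fin n)) (v : Fin n → Bool) (X : ℕ → Config n) : Prop :=
  ∀ b, (∀ i ∉ F, v i = b) → ∀ i ∉ F, ∀ b', Decides X i b' → b' = b

/-- The round in which process `i` decides, `∞` if it never decides. -/
noncomputable def decisionRound (X : ℕ → Config n) (i : Fin n) : ℝ≥0∞ :=
  ⨅ (k : ℕ) (r : ℕ) (b : Bool) (_ : (X k i).decision = some (r, b)), (r : ℝ≥0∞)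

/-- The round by which all non-faulty processes have decided. -/
noncomputable def lastDecisionRound (F : Finset (Fin n)) (X : ℕ → Config n) : ℝ≥0∞ :=
  ⨆ (i : Fin n) (_ : i ∉ F), decisionRound X i

end BBC

namespace BBC

/-! Safety rests on quorum intersection. Since 3t < n, two sets of n - t processes share at least t
+ 1 members, hence a non-faulty one (`exists_notMem_inter`). A non-faulty process sends one AUX
message per tag, so any two views of the same instance meet (`auxView_inter`), and a value enters
`bin` only if it is an input of some non-faulty process (`bin_input`). Hence all singleton AUXSETs
of non-faulty processes in a round carry the same value, at most one binary value enters the second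
broadcast (`input_one_unique`), and `view[r,2]` is {⊥}, {w} or {w, ⊥} (`view2_cases`). A decision on
b in round r forces b into every `view[r,2]`, so the inputs of round r + 1 are unanimous. Unanimity
persists and forces every later decision to be b.

Liveness is an induction on the stage 11 r + (position in round r), which grows by one with each
main step; `roundStart` is counted last, so stage 11 r + 10 means that round r is complete. No wait
statement blocks forever (`eventually_stage_ge`): non-faulty inputs take at most two values, so one
of them is held by t + 1 non-faulty processes, is echoed by all and delivered.

For termination, consider the first time at which a non-faulty process holds `view[r,2]`. The coin
of round r is still hidden (`not_revealed`), but the only binary value that can ever be an input of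
the second broadcast of round r has already been sent in an AUXSET (`exists_auxset_of_later_input`).
So the `candidate` is fixed, and with conditional probability 1/d the coin equals it at all
non-faulty processes. In that case the inputs of round r + 1 are unanimous and everyone decides by
its end. The first such round is geometric with mean d, and one more round gives d + 1. -/

variable {n : ℕ}

/-! ### Stages and reconstructed estimates of a single process -/

/-- Position of a control point within a round. -/
def PC.idx : PC → ℕ
  | .sbvAux s => 6 * s
  | .sbvReturn s => 6 * s + 1
  | .sendAuxset => 2
  | .waitAuxset => 3
  | .setEst => 4
  | .secondSbv => 5
  | .callRandom => 8
  | .finalCase => 9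
  | .roundStart => 10

@[simp] theorem PC.idx_sbvAux (s : Fin 2) : (PC.sbvAux s).idx = 6 * s := rfl
@[simp] theorem PC.idx_sbvReturn (s : Fin 2) : (PC.sbvReturn s).idx = 6 * s + 1 := rfl
@[simp] theorem PC.idx_sendAuxset : PC.sendAuxset.idx = 2 := rfl
@[simp] theorem PC.idx_waitAuxset : PC.waitAuxset.idx = 3 := rfl
@[simp] theorem PC.idx_setEst : PC.setEst.idx = 4 := rfl
@[simp] theorem PC.idx_secondSbv : PC.secondSbv.idx = 5 := rfl
@[simp] theorem PC.idx_callRandom : PC.callRandom.idx = 8 := rfl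
@[simp] theorem PC.idx_finalCase : PC.finalCase.idx = 9 := rfl
@[simp] theorem PC.idx_roundStart : PC.roundStart.idx = 10 := rfl

/-- The number of steps of the main thread, up to a shift. -/
def LocalState.stage (l : LocalState n) : ℕ := 11 * l.round + l.pc.idx

/-- The position in a round from which `view[r, j]` is available. -/
def viewStage : Fin 3 → ℕ
  | 0 => 2
  | 1 => 4
  | 2 => 8

open Classical in
/-- The estimate computed from `view[r,1]`. -/
noncomputable def midEst (V : Set Val) : Val := if h : ∃ w, V = {w} then h.choose else none

open Classical in
/-- The estimate computed at the end of a round from `view[r,2]`, the previous estimate and the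
coin. -/
noncomputable def finalEst (V : Set Val) (e : Val) (s : Bool) : Val :=
  if h : ∃ v : Bool, V = {some v} ∨ V = {some v, none} then some h.choose
  else if V = {none} then some s else e

/-- The input of an SBV-Broadcast instance, reconstructed from the recorded views. -/
noncomputable def LocalState.input (l : LocalState n) (b : Bool) (coin : ℕ → Bool) (τ : Tag) : Val :=
  if τ.2 = 1 then midEst (l.view (τ.1, 1))
  else if τ.1 ≤ 1 then some b
  else finalEst (l.view (τ.1 - 1, 2)) (midEst (l.view (τ.1 - 1, 1))) (coin (τ.1 - 1))

@[simp] theorem midEst_singleton (w : Val) : midEst {w} = w := by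
  have h : ∃ w', ({w} : Set Val) = {w'} := ⟨w, rfl⟩
  rw [midEst, dif_pos h]
  exact (Set.singleton_injective h.choose_spec).symm

theorem midEst_of_ne {V : Set Val} (h : ∀ w, V ≠ {w}) : midEst V = none := by
  rw [midEst, dif_neg]; push Not; exact h

theorem midEst_eq_some {V : Set Val} {w : Bool} (h : midEst V = some w) : V = {some w} := by
  by_cases hV : ∃ w', V = {w'}
  · obtain ⟨w', rfl⟩ := hV
    simp_all
  · push Not at hV
    simp [midEst_of_ne hV] at h

theorem finalEst_of_mem_some {V : Set Val} {e : Val} {s v : Bool}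
    (h : V = {some v} ∨ V = {some v, none}) : finalEst V e s = some v := by
  have h' : ∃ v : Bool, V = {some v} ∨ V = {some v, none} := ⟨v, h⟩
  rw [finalEst, dif_pos h']
  have h1 : some v ∈ V := by rcases h with rfl | rfl <;> simp
  have h2 := h'.choose_spec
  generalize h'.choose = w at h2 ⊢
  rcases h2 with h2 | h2 <;> · rw [h2] at h1; simp at h1; simp [h1]

@[simp] theorem finalEst_bot (e : Val) (s : Bool) : finalEst {none} e s = some s := by
  rw [finalEst, dif_neg, if_pos rfl]
  rintro ⟨v, h | h⟩
  · simpa using Set.singleton_injective h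
  · have : (some v : Val) ∈ ({none} : Set Val) := by rw [h]; simp
    simp at this

/-- This branch belongs to `caseNone`. It is excluded only by the global argument `view2_cases`, so
the local invariant has to cover it. -/
theorem finalEst_of_ne {V : Set Val} {e : Val} {s : Bool} (h1 : ∀ v : Bool, V ≠ {some v})
    (h2 : ∀ v : Bool, V ≠ {some v, none}) (h3 : V ≠ {none}) : finalEst V e s = e := by
  rw [finalEst, dif_neg (by push Not; exact fun v => ⟨h1 v, h2 v⟩), if_neg h3]

/-! ### Monotonicity of local states -/

/-- `l'` extends `l`: nothing that `l` records is forgotten. -/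
structure Extends (l l' : LocalState n) : Prop where
  stage : l.stage ≤ l'.stage
  rcvd : l.rcvd ⊆ l'.rcvd
  sent : l.sent ⊆ l'.sent
  started : l.started ⊆ l'.started
  bin : ∀ τ, l.bin τ ⊆ l'.bin τ
  view : ∀ r j, 11 * r + viewStage j ≤ l.stage → l'.view (r, j) = l.view (r, j)
  decision : ∀ x, l.decision = some x → l'.decision = some x

theorem Extends.refl (l : LocalState n) : Extends l l :=
  ⟨le_rfl, subset_rfl, subset_rfl, subset_rfl, fun _ => subset_rfl, fun _ _ _ => rfl, fun _ h => h⟩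

theorem Extends.trans {l l' l'' : LocalState n} (h : Extends l l') (h' : Extends l' l'') :
    Extends l l'' where
  stage := h.stage.trans h'.stage
  rcvd := h.rcvd.trans h'.rcvd
  sent := h.sent.trans h'.sent
  started := h.started.trans h'.started
  bin τ := (h.bin τ).trans (h'.bin τ)
  view r j hr := (h'.view r j (hr.trans h.stage)).trans (h.view r j hr)
  decision x hx := h'.decision x (h.decision x hx)

theorem Extends.receivedFrom {l l' : LocalState n} (h : Extends l l') {m : Msg} {q : ℕ} :
    l.ReceivedFrom m q → l'.ReceivedFrom m q :=
  fun ⟨Q, hQ, hm⟩ => ⟨Q, hQ, fun j hj => h.rcvd (hm j hj)⟩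

theorem Extends.auxView {l l' : LocalState n} (h : Extends l l') {t : ℕ} {τ : Tag} {V : Set Val} :
    l.AuxView t τ V → l'.AuxView t τ V :=
  fun ⟨Q, w, hQ, hm, hV⟩ =>
    ⟨Q, w, hQ, fun j hj => ⟨h.rcvd (hm j hj).1, h.bin _ (hm j hj).2⟩, hV⟩

theorem Extends.auxsetView {l l' : LocalState n} (h : Extends l l') {t r : ℕ} {V : Set Val} :
    l.AuxsetView t r V → l'.AuxsetView t r V :=
  fun ⟨Q, w, hQ, hm, hV⟩ =>
    ⟨Q, w, hQ, fun j hj => ⟨h.rcvd (hm j hj).1, (hm j hj).2.trans (h.bin _)⟩, hV⟩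

/-- Once an instance has been invoked, the views from which its input is computed are complete and
no longer change. -/
theorem Extends.input {l l' : LocalState n} (h : Extends l l') {r : ℕ} {s : Fin 2}
    (hs : 11 * r + 6 * s ≤ l.stage) (b : Bool) (coin : ℕ → Bool) :
    l'.input b coin (r, s) = l.input b coin (r, s) := by
  have h1 : 11 * r + 4 ≤ l.stage → _ := h.view r 1
  have h2 : 11 * (r - 1) + 4 ≤ l.stage → _ := h.view (r - 1) 1
  have h3 : 11 * (r - 1) + 8 ≤ l.stage → _ := h.view (r - 1) 2
  obtain rfl | rfl : s = 0 ∨ s = 1 := by omega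
  · simp only [LocalState.input]
    by_cases hr : r ≤ 1
    · simp [hr]
    · simp only [Fin.val_zero] at hs
      rw [h2 (by omega), h3 (by omega)]
      rfl
  · simp only [LocalState.input]
    simp only [Fin.val_one] at hs
    rw [h1 (by omega)]
    rfl

/-! ### The invariant of a single process -/

/-- The invariant relating the components of the state of a non-faulty process with proposal `b`
that receives the coin values `coin`. -/
structure LocalInv (t : ℕ) (coin : ℕ → Bool) (b : Bool) (l : LocalState n) : Prop where
  round_pos : l.pc ≠ .roundStart → 1 ≤ l.round
  est_early : l.pc.idx ≤ 4 → l.est = l.input b coin (l.round, 0)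
  est_mid : 5 ≤ l.pc.idx → l.pc.idx ≤ 9 → l.est = l.input b coin (l.round, 1)
  est_end : l.pc = .roundStart → l.est = l.input b coin (l.round + 1, 0)
  coinVal : l.pc = .finalCase → l.coinVal = coin l.round
  coinCalls : ∀ r, r ∈ l.coinCalls ↔ 1 ≤ r ∧ 11 * r + 9 ≤ l.stage
  started : ∀ r s, (r, s) ∈ l.started ↔ 1 ≤ r ∧ 11 * r + 6 * s.val ≤ l.stage
  bval_sent : ∀ τ ∈ l.started, Msg.bval τ (l.input b coin τ) ∈ l.sent
  bin_started : ∀ τ v, v ∈ l.bin τ → τ ∈ l.started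
  bin_rcvd : ∀ τ v, v ∈ l.bin τ → l.ReceivedFrom (.bval τ v) (2 * t + 1)
  aux_stage : ∀ r s w, Msg.aux (r, s) w ∈ l.sent → 11 * r + 6 * s.val + 1 ≤ l.stage
  aux_bin : ∀ τ w, Msg.aux τ w ∈ l.sent → w ∈ l.bin τ
  aux_unique : ∀ τ w w', Msg.aux τ w ∈ l.sent → Msg.aux τ w' ∈ l.sent → w = w'
  aux_exists : ∀ r s, 1 ≤ r → 11 * r + 6 * s.val + 1 ≤ l.stage → ∃ w, Msg.aux (r, s) w ∈ l.sent
  auxset_stage : ∀ r S, Msg.auxset r S ∈ l.sent → 1 ≤ r ∧ 11 * r + 3 ≤ l.stage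
  auxset_view : ∀ r S, Msg.auxset r S ∈ l.sent → S = l.view (r, 0)
  auxset_exists : ∀ r, 1 ≤ r → 11 * r + 3 ≤ l.stage → Msg.auxset r (l.view (r, 0)) ∈ l.sent
  view0 : ∀ r, 1 ≤ r → 11 * r + 2 ≤ l.stage → l.AuxView t (r, 0) (l.view (r, 0))
  view1 : ∀ r, 1 ≤ r → 11 * r + 4 ≤ l.stage → l.AuxsetView t r (l.view (r, 1))
  view2 : ∀ r, 1 ≤ r → 11 * r + 8 ≤ l.stage → l.AuxView t (r, 1) (l.view (r, 2))
  decision : ∀ r v, l.decision = some (r, v) →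
    1 ≤ r ∧ 11 * r + 10 ≤ l.stage ∧ l.view (r, 2) = {some v}
  decided : ∀ r v, 1 ≤ r → 11 * r + 10 ≤ l.stage → l.view (r, 2) = {some v} →
    ∃ r' ≤ r, ∃ v', l.decision = some (r', v')

theorem PC.idx_le (p : PC) : p.idx ≤ 10 := by
  cases p <;> simp <;> omega

theorem LocalInv.init (t : ℕ) (coin : ℕ → Bool) (b : Bool) :
    LocalInv t coin b (LocalState.init n b) := by
  constructor <;> simp [LocalState.init, LocalState.stage, PC.idx, LocalState.input] <;>
    intros <;> omega

@[simp] theorem afterSbv_idx (s : Fin 2) : (afterSbv s).idx = 6 * s.val + 2 := by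
  obtain rfl | rfl : s = 0 ∨ s = 1 := by omega
  all_goals rfl

/-- The start of a round leads from 11 r + 10 to 11 (r + 1), which is why `roundStart` has the last
position. -/
theorem ThreadStep.stage_main {t : ℕ} {coin : ℕ → Bool} {l l' : LocalState n}
    (h : ThreadStep t coin .main l l') : l'.stage = l.stage + 1 := by
  cases h <;> simp [LocalState.stage, LocalState.invoke, LocalState.broadcast, *] <;> omega

theorem ThreadStep.extends {t : ℕ} {coin : ℕ → Bool} {b : Bool} {th : Thread}
    {l l' : LocalState n} (hl : LocalInv t coin b l) (h : ThreadStep t coin th l l') :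
    Extends l l' := by
  constructor
  · cases th
    · exact h.stage_main ▸ Nat.le_succ _
    · cases h; exact le_rfl
    · cases h; exact le_rfl
  · cases h <;> exact subset_rfl
  · cases h <;> first | exact subset_rfl | exact Set.subset_insert _ _
  · cases h <;> first | exact subset_rfl | exact Set.subset_insert _ _
  -- Invocation empties `bin` at its tag, but loses nothing: a nonempty `bin` belongs to a started
  -- instance, and the instance being invoked lies above the current stage.
  · intro τ x hx
    have h1 := hl.bin_started τ x hx
    obtain ⟨r, s⟩ := τ
    have h2 := (hl.started r s).1 h1
    have h3 := h2.2
    cases h <;> simp only [LocalState.stage, LocalState.invoke, LocalState.broadcast,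
      Function.update_apply] at h2 h3 ⊢ <;> first
      | exact hx
      | (rw [if_neg]; exact hx; rintro h; rw [Prod.mk.injEq] at h; simp_all; omega)
      | (split <;> simp_all)
  -- A step writes `view (r, j)` only when leaving stage 11 r + `viewStage j` - 1, just before the
  -- view becomes frozen.
  · intro r j hr
    have : viewStage j = 2 ∧ j = 0 ∨ viewStage j = 4 ∧ j = 1 ∨ viewStage j = 8 ∧ j = 2 := by
      fin_cases j <;> simp [viewStage]
    cases h <;> first
      | rfl
      | (simp_all only [LocalState.stage, PC.idx_sbvReturn, PC.idx_waitAuxset, viewIndex,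
          Function.update_apply]
         split <;> grind)
  · intro x hx
    cases h <;> first
      | exact hx
      | simp [hx]

section

variable {t r : ℕ} {coin : ℕ → Bool} {b : Bool} {th : Thread}
    {l l' : LocalState n}

theorem LocalState.input_one : l.input b coin (r, 1) = midEst (l.view (r, 1)) := if_pos rfl

theorem LocalState.input_zero_succ (hr : 1 ≤ r) : l.input b coin (r + 1, 0) =
    finalEst (l.view (r, 2)) (midEst (l.view (r, 1))) (coin r) := by
  rw [LocalState.input, if_neg (by simp), if_neg (by simp; omega)]
  rfl

theorem ThreadStep.inv_round_pos (hl : LocalInv t coin b l) (h : ThreadStep t coin th l l') :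
    l'.pc ≠ .roundStart → 1 ≤ l'.round := by
  have := hl.round_pos
  cases h <;> simp_all [LocalState.invoke, LocalState.broadcast]

theorem ThreadStep.inv_est_early (hl : LocalInv t coin b l) (h : ThreadStep t coin th l l') :
    l'.pc.idx ≤ 4 → l'.est = l'.input b coin (l'.round, 0) := by
  have h1 := hl.est_early
  have h2 := hl.est_end
  have hx := h.extends hl
  have hin := fun r (h : 11 * r + 6 * 0 ≤ l.stage) => hx.input (s := 0) h b coin
  cases h
  case roundStart h => exact fun _ => h2 h
  all_goals
    simp only [LocalState.invoke, LocalState.broadcast, LocalState.stage] at hin ⊢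
    grind [PC.idx_le, PC.idx, afterSbv_idx]

theorem ThreadStep.inv_est_mid (hl : LocalInv t coin b l) (h : ThreadStep t coin th l l') :
    5 ≤ l'.pc.idx → l'.pc.idx ≤ 9 → l'.est = l'.input b coin (l'.round, 1) := by
  have h1 := hl.est_mid
  cases h <;> simp only [LocalState.invoke, LocalState.broadcast, LocalState.input_one] at h1 ⊢ <;>
    grind [PC.idx, afterSbv, viewIndex, midEst_singleton, midEst_of_ne]

theorem ThreadStep.inv_est_end (hl : LocalInv t coin b l) (h : ThreadStep t coin th l l') :
    l'.pc = .roundStart → l'.est = l'.input b coin (l'.round + 1, 0) := by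
  have h1 := hl.est_mid
  have h2 := hl.est_end
  have h3 := hl.round_pos
  have h4 := hl.coinVal
  cases h
  case bvEcho | bvDeliver => exact h2
  all_goals
    simp_all only [LocalState.invoke, LocalState.broadcast, LocalState.input_one, PC.idx_finalCase]
  all_goals first
    | (simp; done)
    | (rw [LocalState.input_zero_succ (h3 (by simp))]; intro _;
       first
        | (simp_all; done)
        | rw [finalEst_of_mem_some (Or.inl ‹_›)]
        | rw [finalEst_of_mem_some (Or.inr ‹_›)]
        | (rw [finalEst_of_ne ‹_› ‹_› ‹_›]; simp_all))
    | grind [afterSbv]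

theorem ThreadStep.inv_coinVal (hl : LocalInv t coin b l) (h : ThreadStep t coin th l l') :
    l'.pc = .finalCase → l'.coinVal = coin l'.round := by
  have h4 := hl.coinVal
  cases h <;> simp only [LocalState.invoke, LocalState.broadcast] <;>
    grind [afterSbv]

theorem ThreadStep.inv_coinCalls (hl : LocalInv t coin b l) (h : ThreadStep t coin th l l') :
    ∀ r, r ∈ l'.coinCalls ↔ 1 ≤ r ∧ 11 * r + 9 ≤ l'.stage := by
  have h4 := hl.coinCalls
  have h3 := hl.round_pos
  cases h <;> simp only [LocalState.invoke, LocalState.broadcast, LocalState.stage] at h4 ⊢ <;>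
    grind [PC.idx_le, PC.idx, afterSbv_idx]

theorem ThreadStep.inv_started (hl : LocalInv t coin b l) (h : ThreadStep t coin th l l') :
    ∀ r s, (r, s) ∈ l'.started ↔ 1 ≤ r ∧ 11 * r + 6 * s.val ≤ l'.stage := by
  have h4 := hl.started
  have h3 := hl.round_pos
  cases h <;> simp only [LocalState.invoke, LocalState.broadcast, LocalState.stage] at h4 ⊢ <;>
    grind [PC.idx_le, PC.idx, afterSbv_idx]

theorem ThreadStep.inv_bval_sent (hl : LocalInv t coin b l) (h : ThreadStep t coin th l l') :
    ∀ τ ∈ l'.started, Msg.bval τ (l'.input b coin τ) ∈ l'.sent := by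
  have hx := h.extends hl
  have key : ∀ τ ∈ l.started, Msg.bval τ (l'.input b coin τ) ∈ l'.sent := by
    intro τ hτ
    rw [hx.input ((hl.started _ _).1 hτ).2]
    exact hx.sent (hl.bval_sent τ hτ)
  have h1 := hl.est_end
  have h2 := hl.est_mid
  cases h <;> try exact key
  all_goals
    rintro τ (rfl | hτ)
    · left
      simp_all [LocalState.invoke]
      rfl
    · exact key τ hτ

theorem ThreadStep.inv_bin_started (hl : LocalInv t coin b l) (h : ThreadStep t coin th l l') :
    ∀ τ v, v ∈ l'.bin τ → τ ∈ l'.started := by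
  have h4 := hl.bin_started
  cases h <;> simp only [LocalState.invoke, LocalState.broadcast] <;>
    grind

theorem ThreadStep.inv_bin_rcvd (hl : LocalInv t coin b l) (h : ThreadStep t coin th l l') :
    ∀ τ v, v ∈ l'.bin τ → l'.ReceivedFrom (.bval τ v) (2 * t + 1) := by
  have hx := h.extends hl
  intro τ v hv
  refine hx.receivedFrom ?_
  have h4 := hl.bin_rcvd
  cases h <;> simp only [LocalState.invoke, LocalState.broadcast] at hv <;>
    grind

theorem ThreadStep.inv_aux_stage (hl : LocalInv t coin b l) (h : ThreadStep t coin th l l') :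
    ∀ r s w, Msg.aux (r, s) w ∈ l'.sent → 11 * r + 6 * s.val + 1 ≤ l'.stage := by
  have hx := h.extends hl
  intro r s w hw
  have key : Msg.aux (r, s) w ∈ l.sent → 11 * r + 6 * s.val + 1 ≤ l'.stage :=
    fun hw => (hl.aux_stage r s w hw).trans hx.stage
  cases h <;> try exact key hw
  all_goals
    rcases hw with hw | hw
    · simp_all [LocalState.stage, LocalState.invoke, LocalState.broadcast]
    · exact key hw

theorem ThreadStep.inv_aux_bin (hl : LocalInv t coin b l) (h : ThreadStep t coin th l l') :
    ∀ τ w, Msg.aux τ w ∈ l'.sent → w ∈ l'.bin τ := by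
  have hx := h.extends hl
  intro τ w hw
  have key : Msg.aux τ w ∈ l.sent → w ∈ l'.bin τ :=
    fun hw => hx.bin _ (hl.aux_bin τ w hw)
  cases h <;> try exact key hw
  all_goals
    rcases hw with hw | hw
    · simp_all [LocalState.invoke, LocalState.broadcast]
    · exact key hw

theorem ThreadStep.inv_aux_unique (hl : LocalInv t coin b l) (h : ThreadStep t coin th l l') :
    ∀ τ w w', Msg.aux τ w ∈ l'.sent → Msg.aux τ w' ∈ l'.sent → w = w' := by
  have h1 := hl.aux_unique
  have h2 := hl.aux_stage
  cases h <;> simp only [LocalState.invoke, LocalState.broadcast, LocalState.stage] at h2 ⊢ <;>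
    grind [PC.idx_sbvAux]

theorem ThreadStep.inv_aux_exists (hl : LocalInv t coin b l) (h : ThreadStep t coin th l l') :
    ∀ r s, 1 ≤ r → 11 * r + 6 * s.val + 1 ≤ l'.stage → ∃ w, Msg.aux (r, s) w ∈ l'.sent := by
  intro r s hr hs
  have hx := h.extends hl
  have key : 11 * r + 6 * s.val + 1 ≤ l.stage → ∃ w, Msg.aux (r, s) w ∈ l'.sent :=
    fun h => (hl.aux_exists r s hr h).imp fun w hw => hx.sent hw
  cases h <;> simp only [LocalState.invoke, LocalState.broadcast, LocalState.stage] at key hs ⊢ <;>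
    grind [PC.idx_le, PC.idx, afterSbv_idx]

theorem ThreadStep.inv_auxset_stage (hl : LocalInv t coin b l) (h : ThreadStep t coin th l l') :
    ∀ r S, Msg.auxset r S ∈ l'.sent → 1 ≤ r ∧ 11 * r + 3 ≤ l'.stage := by
  have hx := h.extends hl
  intro r S hw
  have h3 := hl.round_pos
  have key : Msg.auxset r S ∈ l.sent → 1 ≤ r ∧ 11 * r + 3 ≤ l'.stage :=
    fun hw => (hl.auxset_stage r S hw).imp_right fun h => h.trans hx.stage
  cases h <;> try exact key hw
  all_goals
    rcases hw with hw | hw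
    · simp_all [LocalState.stage, LocalState.invoke, LocalState.broadcast]
    · exact key hw

theorem ThreadStep.inv_auxset_view (hl : LocalInv t coin b l) (h : ThreadStep t coin th l l') :
    ∀ r S, Msg.auxset r S ∈ l'.sent → S = l'.view (r, 0) := by
  have hx := h.extends hl
  intro r S hw
  have key : Msg.auxset r S ∈ l.sent → S = l'.view (r, 0) :=
    fun hw => (hl.auxset_view r S hw).trans
      (hx.view r 0 (le_trans (Nat.le_succ _) (hl.auxset_stage r S hw).2)).symm
  cases h <;> try exact key hw
  all_goals
    rcases hw with hw | hw
    · simp_all [LocalState.invoke, LocalState.broadcast]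
    · exact key hw

theorem ThreadStep.inv_auxset_exists (hl : LocalInv t coin b l) (h : ThreadStep t coin th l l') :
    ∀ r, 1 ≤ r → 11 * r + 3 ≤ l'.stage → Msg.auxset r (l'.view (r, 0)) ∈ l'.sent := by
  intro r hr hs
  have hx := h.extends hl
  have key : 11 * r + 3 ≤ l.stage → Msg.auxset r (l'.view (r, 0)) ∈ l'.sent := by
    intro h'
    rw [hx.view r 0 (le_trans (Nat.le_succ _) h')]
    exact hx.sent (hl.auxset_exists r hr h')
  cases h <;> simp only [LocalState.invoke, LocalState.broadcast, LocalState.stage] at key hs ⊢ <;>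
    grind [PC.idx_le, PC.idx, afterSbv_idx]

theorem ThreadStep.inv_view0 (hl : LocalInv t coin b l) (h : ThreadStep t coin th l l') :
    ∀ r, 1 ≤ r → 11 * r + 2 ≤ l'.stage → l'.AuxView t (r, 0) (l'.view (r, 0)) := by
  intro r hr hs
  have hx := h.extends hl
  refine hx.auxView ?_
  have key : 11 * r + 2 ≤ l.stage → l.AuxView t (r, 0) (l'.view (r, 0)) := by
    intro h'
    rw [hx.view r 0 h']
    exact hl.view0 r hr h'
  cases h <;> simp only [LocalState.invoke, LocalState.broadcast, LocalState.stage] at key hs ⊢ <;>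
    grind [PC.idx_le, PC.idx, afterSbv_idx, viewIndex]

theorem ThreadStep.inv_view1 (hl : LocalInv t coin b l) (h : ThreadStep t coin th l l') :
    ∀ r, 1 ≤ r → 11 * r + 4 ≤ l'.stage → l'.AuxsetView t r (l'.view (r, 1)) := by
  intro r hr hs
  have hx := h.extends hl
  refine hx.auxsetView ?_
  have key : 11 * r + 4 ≤ l.stage → l.AuxsetView t r (l'.view (r, 1)) := by
    intro h'
    rw [hx.view r 1 h']
    exact hl.view1 r hr h'
  cases h <;> simp only [LocalState.invoke, LocalState.broadcast, LocalState.stage] at key hs ⊢ <;>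
    grind [PC.idx_le, PC.idx, afterSbv_idx, viewIndex]

theorem ThreadStep.inv_view2 (hl : LocalInv t coin b l) (h : ThreadStep t coin th l l') :
    ∀ r, 1 ≤ r → 11 * r + 8 ≤ l'.stage → l'.AuxView t (r, 1) (l'.view (r, 2)) := by
  intro r hr hs
  have hx := h.extends hl
  refine hx.auxView ?_
  have key : 11 * r + 8 ≤ l.stage → l.AuxView t (r, 1) (l'.view (r, 2)) := by
    intro h'
    rw [hx.view r 2 h']
    exact hl.view2 r hr h'
  cases h <;> simp only [LocalState.invoke, LocalState.broadcast, LocalState.stage] at key hs ⊢ <;>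
    grind [PC.idx_le, PC.idx, afterSbv_idx, viewIndex]

theorem ThreadStep.inv_decision (hl : LocalInv t coin b l) (h : ThreadStep t coin th l l') :
    ∀ r v, l'.decision = some (r, v) →
    1 ≤ r ∧ 11 * r + 10 ≤ l'.stage ∧ l'.view (r, 2) = {some v} := by
  intro r v hd
  have hx := h.extends hl
  have key : l.decision = some (r, v) →
      1 ≤ r ∧ 11 * r + 10 ≤ l'.stage ∧ l'.view (r, 2) = {some v} := by
    intro h'
    obtain ⟨h1, h2, h3⟩ := hl.decision r v h'
    rw [hx.view r 2 (le_trans (Nat.le_add_right _ 2) h2)]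
    exact ⟨h1, h2.trans hx.stage, h3⟩
  have h3 := hl.round_pos
  cases h <;> try exact key hd
  cases h4 : l.decision <;> simp_all [LocalState.stage]

theorem ThreadStep.inv_decided (hl : LocalInv t coin b l) (h : ThreadStep t coin th l l') :
    ∀ r v, 1 ≤ r → 11 * r + 10 ≤ l'.stage → l'.view (r, 2) = {some v} →
    ∃ r' ≤ r, ∃ v', l'.decision = some (r', v') := by
  intro r v hr hs hv
  have hx := h.extends hl
  have key : 11 * r + 10 ≤ l.stage → ∃ r' ≤ r, ∃ v', l'.decision = some (r', v') := by
    intro h'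
    rw [hx.view r 2 (le_trans (Nat.le_add_right _ 2) h')] at hv
    obtain ⟨r', h1, v', h2⟩ := hl.decided r v hr h' hv
    exact ⟨r', h1, v', hx.decision _ h2⟩
  have h5 := hl.decision
  have h6 : ∀ v w : Bool, ({some v} : Set Val) ≠ {some w, none} := by
    intro v w h
    have : (none : Val) ∈ ({some v} : Set Val) := by rw [h]; simp
    simp at this
  cases h
  case caseDecide v' h7 h8 =>
    -- A decision made before belongs to a strictly earlier round and serves as the witness.
    cases h9 : l.decision with
    | some x =>
      have h10 := h5 x.1 x.2 h9
      simp only [LocalState.stage, h9, h7, PC.idx] at key hs h10 ⊢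
      by_cases hr' : r = l.round
      · exact ⟨x.1, by omega, x.2, rfl⟩
      · exact key (by omega)
    | none => 
      simp only [LocalState.stage, h9, h7, PC.idx] at key hs ⊢
      grind
  all_goals
    simp only [LocalState.invoke, LocalState.broadcast, LocalState.stage] at key hs h5 ⊢
    grind [PC.idx_le, PC.idx, afterSbv_idx, viewIndex]

theorem ThreadStep.localInv (hl : LocalInv t coin b l) (h : ThreadStep t coin th l l') :
    LocalInv t coin b l' :=
  ⟨ThreadStep.inv_round_pos hl h, ThreadStep.inv_est_early hl h, ThreadStep.inv_est_mid hl h,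
    ThreadStep.inv_est_end hl h, ThreadStep.inv_coinVal hl h, ThreadStep.inv_coinCalls hl h,
    ThreadStep.inv_started hl h, ThreadStep.inv_bval_sent hl h, ThreadStep.inv_bin_started hl h,
    ThreadStep.inv_bin_rcvd hl h, ThreadStep.inv_aux_stage hl h, ThreadStep.inv_aux_bin hl h,
    ThreadStep.inv_aux_unique hl h, ThreadStep.inv_aux_exists hl h,
    ThreadStep.inv_auxset_stage hl h, ThreadStep.inv_auxset_view hl h,
    ThreadStep.inv_auxset_exists hl h, ThreadStep.inv_view0 hl h, ThreadStep.inv_view1 hl h,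
    ThreadStep.inv_view2 hl h, ThreadStep.inv_decision hl h, ThreadStep.inv_decided hl h⟩

theorem LocalState.extends_receive (l : LocalState n) (x : Fin n × Msg) :
    Extends l { l with rcvd := insert x l.rcvd } where
  stage := le_rfl
  rcvd := Set.subset_insert _ _
  sent := subset_rfl
  started := subset_rfl
  bin _ := subset_rfl
  view _ _ _ := rfl
  decision _ h := h

theorem LocalInv.receive (hl : LocalInv t coin b l) (x : Fin n × Msg) :
    LocalInv t coin b { l with rcvd := insert x l.rcvd } where
  __ := hl
  bin_rcvd τ v hv := (l.extends_receive x).receivedFrom (hl.bin_rcvd τ v hv)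
  view0 r h h' := (l.extends_receive x).auxView (hl.view0 r h h')
  view1 r h h' := (l.extends_receive x).auxsetView (hl.view1 r h h')
  view2 r h h' := (l.extends_receive x).auxView (hl.view2 r h h')

end

/-! ### The global invariant and quorum intersection -/

section

/-- The input of process `i` to the SBV-Broadcast instance `τ`. -/
noncomputable def Config.input (c : Config n) (v : Fin n → Bool) (coin : ℕ → Fin n → Bool)
    (i : Fin n) (τ : Tag) : Val :=
  (c i).input (v i) (fun r => coin r i) τ

/-- The invariant of the system. -/
structure GlobalInv (t : ℕ) (F : Finset (Fin n)) (v : Fin n → Bool) (coin : ℕ → Fin n → Bool)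
    (c : Config n) : Prop where
  localInv : ∀ i ∉ F, LocalInv t (fun r => coin r i) (v i) (c i)
  rcvd : ∀ i ∉ F, ∀ j ∉ F, ∀ m, (j, m) ∈ (c i).rcvd → m ∈ (c j).sent
  bval : ∀ i ∉ F, ∀ τ x, Msg.bval τ x ∈ (c i).sent →
    ∃ j ∉ F, τ ∈ (c j).started ∧ c.input v coin j τ = x

variable {t : ℕ} {F : Finset (Fin n)} {v : Fin n → Bool} {coin : ℕ → Fin n → Bool}
  {c c' : Config n}

theorem exists_notMem_of_lt_card {Q : Finset (Fin n)} (hF : F.card ≤ t) (hQ : t + 1 ≤ Q.card) :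
    ∃ j ∈ Q, j ∉ F := by
  by_contra! h
  have := Finset.card_le_card (show Q ⊆ F from h)
  omega

/-- The intersection has at least 2 (n - t) - n = n - 2t ≥ t + 1 elements, of which at most t are
faulty. -/
theorem exists_notMem_inter (htn : 3 * t < n) (hF : F.card ≤ t) {Q Q' : Finset (Fin n)}
    (hQ : n - t ≤ Q.card) (hQ' : n - t ≤ Q'.card) : ∃ j ∈ Q, j ∈ Q' ∧ j ∉ F := by
  have h1 := Finset.card_union_add_card_inter Q Q'
  have h2 := Finset.card_le_univ (Q ∪ Q')
  rw [Fintype.card_fin] at h2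
  obtain ⟨j, hj, hjF⟩ := exists_notMem_of_lt_card (Q := Q ∩ Q') hF (by omega)
  rw [Finset.mem_inter] at hj
  exact ⟨j, hj.1, hj.2, hjF⟩

theorem GlobalInv.init : GlobalInv t F v coin (initConfig v) where
  localInv i _ := LocalInv.init t _ (v i)
  rcvd i _ j _ m h := by simp [initConfig, LocalState.init] at h
  bval i _ τ x h := by simp [initConfig, LocalState.init] at h

theorem Step.extends (hc : GlobalInv t F v coin c) {a : Action n} (h : Step t F coin c a c')
    (i : Fin n) : Extends (c i) (c' i) := by
  cases h with
  | thread j th l hj hl =>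
    by_cases hij : i = j
    · subst hij; simpa using hl.extends (hc.localInv i hj)
    · simpa [hij] using Extends.refl (c i)
  | recv j k m hj =>
    by_cases hij : i = j
    · subst hij; simpa using (c i).extends_receive (k, m)
    · simpa [hij] using Extends.refl (c i)
  | idle => exact Extends.refl _

theorem Config.input_eq_of_extends (hc : GlobalInv t F v coin c) {i : Fin n} (hi : i ∉ F)
    (h : Extends (c i) (c' i)) {τ : Tag} (hτ : τ ∈ (c i).started) :
    c'.input v coin i τ = c.input v coin i τ :=
  h.input (((hc.localInv i hi).started τ.1 τ.2).1 hτ).2 _ _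

theorem ThreadStep.bval_sent {coin : ℕ → Bool} {b : Bool} {th : Thread} {l l' : LocalState n}
    (hl : LocalInv t coin b l) (h : ThreadStep t coin th l l') {τ : Tag} {x : Val}
    (hx : Msg.bval τ x ∈ l'.sent) :
    Msg.bval τ x ∈ l.sent ∨ l.ReceivedFrom (.bval τ x) (t + 1) ∨
      τ ∈ l'.started ∧ l'.input b coin τ = x := by
  have hl' := h.localInv hl
  have h1 := hl'.est_early
  have h2 := hl'.est_mid
  cases h
  case roundStart =>
    rcases hx with hx | hx
    · obtain ⟨rfl, rfl⟩ := Msg.bval.inj hx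
      exact Or.inr (Or.inr ⟨Set.mem_insert _ _, (h1 (by simp)).symm⟩)
    · exact Or.inl hx
  case secondSbv =>
    rcases hx with hx | hx
    · obtain ⟨rfl, rfl⟩ := Msg.bval.inj hx
      exact Or.inr (Or.inr ⟨Set.mem_insert _ _, (h2 (by simp) (by simp)).symm⟩)
    · exact Or.inl hx
  case bvEcho =>
    rcases hx with hx | hx
    · obtain ⟨rfl, rfl⟩ := Msg.bval.inj hx
      exact Or.inr (Or.inl ‹_›)
    · exact Or.inl hx
  case sbvAux | sendAuxset =>
    rcases hx with hx | hx
    · cases hx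
    · exact Or.inl hx
  all_goals exact Or.inl hx

/-- The clause `bval` survives echoes because t + 1 senders include a non-faulty one, whose own
message can already be traced to an input. -/
theorem Step.globalInv (hF : F.card ≤ t) (hc : GlobalInv t F v coin c) {a : Action n}
    (h : Step t F coin c a c') : GlobalInv t F v coin c' := by
  have hx := h.extends hc
  have hb : ∀ i ∉ F, ∀ τ x, Msg.bval τ x ∈ (c i).sent →
      ∃ j ∉ F, τ ∈ (c' j).started ∧ c'.input v coin j τ = x := by
    intro i hi τ x hm
    obtain ⟨j, hj, h1, h2⟩ := hc.bval i hi τ x hm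
    exact ⟨j, hj, (hx j).started h1, (Config.input_eq_of_extends hc hj (hx j) h1).trans h2⟩
  cases h with
  | thread i th l hi hl =>
    refine ⟨fun j hj => ?_, fun j hj k hk m hm => ?_, fun j hj τ x hm => ?_⟩
    · by_cases hij : j = i
      · subst hij; simpa using hl.localInv (hc.localInv j hj)
      · simpa [hij] using hc.localInv j hj
    · refine (hx k).sent (hc.rcvd j hj k hk m ?_)
      by_cases hij : j = i
      · subst hij
        rw [Function.update_self] at hm
        cases hl <;> exact hm
      · simpa [hij] using hm
    · by_cases hij : j = i
      · subst hij
        have hm' := hm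
        rw [Function.update_self] at hm'
        rcases hl.bval_sent (hc.localInv j hj) hm' with h | ⟨Q, hQ, hQm⟩ | h
        · exact hb j hj τ x h
        · obtain ⟨k, hk, hkF⟩ := exists_notMem_of_lt_card hF hQ
          exact hb k hkF τ x (hc.rcvd j hj k hkF _ (hQm k hk))
        · exact ⟨j, hj, by simpa [Config.input] using h⟩
      · exact hb j hj τ x (by simpa [hij] using hm)
  | recv i k m hi hk =>
    refine ⟨fun j hj => ?_, fun j hj k' hk' m' hm => (hx k').sent ?_, fun j hj τ x hm => ?_⟩
    · by_cases hij : j = i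
      · subst hij; simpa using (hc.localInv j hj).receive (k, m)
      · simpa [hij] using hc.localInv j hj
    · by_cases hij : j = i
      · subst hij
        rw [Function.update_self] at hm
        rcases hm with hm | hm
        · obtain ⟨rfl, rfl⟩ := Prod.mk.inj hm
          exact hk.resolve_left hk'
        · exact hc.rcvd j hj k' hk' m' hm
      · exact hc.rcvd j hj k' hk' m' (by simpa [hij] using hm)
    · refine hb j hj τ x ?_
      by_cases hij : j = i
      · subst hij; simpa using hm
      · simpa [hij] using hm
  | idle => exact hc

theorem IsExecution.globalInv (hF : F.card ≤ t) {X : ℕ → Config n} {a : ℕ → Action n}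
    (h : IsExecution t F v coin X a) (k : ℕ) : GlobalInv t F v coin (X k) := by
  induction k with
  | zero => exact h.init ▸ GlobalInv.init
  | succ k ih => exact (h.step k).globalInv hF ih

theorem IsExecution.extends (hF : F.card ≤ t) {X : ℕ → Config n} {a : ℕ → Action n}
    (h : IsExecution t F v coin X a) {k k' : ℕ} (hk : k ≤ k') (i : Fin n) :
    Extends (X k i) (X k' i) := by
  induction hk with
  | refl => exact Extends.refl _
  | step _ ih => exact ih.trans ((h.step _).extends (h.globalInv hF _) i)

/-! ### Safety -/

namespace GlobalInv

theorem started_iff (hc : GlobalInv t F v coin c) {i : Fin n} (hi : i ∉ F) (r : ℕ) (s : Fin 2) :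
    (r, s) ∈ (c i).started ↔ 1 ≤ r ∧ 11 * r + 6 * s.val ≤ (c i).stage :=
  (hc.localInv i hi).started r s

/-- Here t + 1 senders would be enough; the threshold 2t + 1 is needed for liveness, in
`eventually_mem_bin_of_mem_bin`. -/
theorem bin_input (hc : GlobalInv t F v coin c) (hF : F.card ≤ t) {i : Fin n} (hi : i ∉ F)
    {τ : Tag} {x : Val}
    (hx : x ∈ (c i).bin τ) : ∃ j ∉ F, τ ∈ (c j).started ∧ c.input v coin j τ = x := by
  obtain ⟨Q, hQ, hm⟩ := (hc.localInv i hi).bin_rcvd τ x hx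
  obtain ⟨j, hj, hjF⟩ := exists_notMem_of_lt_card hF (show t + 1 ≤ Q.card by omega)
  exact hc.bval j hjF τ x (hc.rcvd i hi j hjF _ (hm j hj))

theorem auxView_input (hc : GlobalInv t F v coin c) (hF : F.card ≤ t) {i : Fin n} (hi : i ∉ F)
    {τ : Tag} {V : Set Val}
    (hV : (c i).AuxView t τ V) {x : Val} (hx : x ∈ V) :
    ∃ j ∉ F, τ ∈ (c j).started ∧ c.input v coin j τ = x := by
  obtain ⟨Q, w, hQ, hm, rfl⟩ := hV
  obtain ⟨j, hj, rfl⟩ := hx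
  exact hc.bin_input hF hi (hm j hj).2

/-- A non-faulty process in both quorums sent a single AUX message for `τ` and contributes the same
value to both views. With `i = j` this says that a view is nonempty. -/
theorem auxView_inter (hc : GlobalInv t F v coin c) (htn : 3 * t < n) (hF : F.card ≤ t)
    {i j : Fin n} (hi : i ∉ F)
    (hj : j ∉ F) {τ : Tag} {V V' : Set Val} (hV : (c i).AuxView t τ V)
    (hV' : (c j).AuxView t τ V') : ∃ x ∈ V, x ∈ V' := by
  obtain ⟨Q, w, hQ, hm, rfl⟩ := hV
  obtain ⟨Q', w', hQ', hm', rfl⟩ := hV'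
  obtain ⟨k, hk, hk', hkF⟩ := exists_notMem_inter htn hF hQ hQ'
  refine ⟨w k, ⟨k, hk, rfl⟩, k, hk', ?_⟩
  exact (hc.localInv k hkF).aux_unique τ _ _ (hc.rcvd j hj k hkF _ (hm' k hk').1)
    (hc.rcvd i hi k hkF _ (hm k hk).1)

/-- Both singletons are first views of round `r`, and such views meet. -/
theorem auxset_unique (hc : GlobalInv t F v coin c) (htn : 3 * t < n) (hF : F.card ≤ t)
    {i j : Fin n} (hi : i ∉ F)
    (hj : j ∉ F) {r : ℕ} {x y : Val} (hx : Msg.auxset r {x} ∈ (c i).sent)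
    (hy : Msg.auxset r {y} ∈ (c j).sent) : x = y := by
  have li := hc.localInv i hi
  have lj := hc.localInv j hj
  have hr := li.auxset_stage r _ hx
  have hr' := lj.auxset_stage r _ hy
  have h1 := li.view0 r hr.1 (by omega)
  have h2 := lj.view0 r hr.1 (by omega)
  rw [← li.auxset_view r _ hx] at h1
  rw [← lj.auxset_view r _ hy] at h2
  obtain ⟨z, rfl, rfl⟩ := hc.auxView_inter htn hF hi hj h1 h2
  rfl

theorem auxset_nonempty (hc : GlobalInv t F v coin c) (htn : 3 * t < n) (hF : F.card ≤ t)
    {i : Fin n} (hi : i ∉ F) {r : ℕ}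
    {S : Set Val} (hS : Msg.auxset r S ∈ (c i).sent) : S.Nonempty := by
  have li := hc.localInv i hi
  have hr := li.auxset_stage r _ hS
  have h1 := li.view0 r hr.1 (by omega)
  rw [← li.auxset_view r _ hS] at h1
  obtain ⟨z, hz, -⟩ := hc.auxView_inter htn hF hi hi h1 h1
  exact ⟨z, hz⟩

/-- The second quorum is arbitrary so that `exists_auxset_of_later_input` can take the senders of
AUX messages for it. -/
theorem auxsetView_inter (hc : GlobalInv t F v coin c) (htn : 3 * t < n) (hF : F.card ≤ t)
    {i : Fin n} (hi : i ∉ F) {r : ℕ}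
    {V : Set Val} (hV : (c i).AuxsetView t r V) {Q' : Finset (Fin n)} (hQ' : n - t ≤ Q'.card) :
    ∃ j ∈ Q', j ∉ F ∧ ∃ S ⊆ V, Msg.auxset r S ∈ (c j).sent := by
  obtain ⟨Q, S, hQ, hm, rfl⟩ := hV
  obtain ⟨k, hk, hk', hkF⟩ := exists_notMem_inter htn hF hQ hQ'
  exact ⟨k, hk', hkF, S k, fun x hx => ⟨k, hk, hx⟩, hc.rcvd i hi k hkF _ (hm k hk).1⟩

theorem auxsetView_nonempty (hc : GlobalInv t F v coin c) (htn : 3 * t < n) (hF : F.card ≤ t)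
    {i : Fin n} (hi : i ∉ F) {r : ℕ}
    {V : Set Val} (hV : (c i).AuxsetView t r V) : V.Nonempty := by
  obtain ⟨j, -, hj, S, hS, hm⟩ := hc.auxsetView_inter htn hF hi hV (Q' := Finset.univ) (by simp)
  exact (hc.auxset_nonempty htn hF hj hm).mono hS

theorem auxsetView_singleton (hc : GlobalInv t F v coin c) (htn : 3 * t < n) (hF : F.card ≤ t)
    {i : Fin n} (hi : i ∉ F) {r : ℕ}
    {x : Val} (hV : (c i).AuxsetView t r {x}) {Q' : Finset (Fin n)} (hQ' : n - t ≤ Q'.card) :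
    ∃ j ∈ Q', j ∉ F ∧ Msg.auxset r {x} ∈ (c j).sent := by
  obtain ⟨j, hj, hjF, S, hS, hm⟩ := hc.auxsetView_inter htn hF hi hV hQ'
  obtain rfl := (hc.auxset_nonempty htn hF hjF hm).subset_singleton_iff.1 hS
  exact ⟨j, hj, hjF, hm⟩

theorem view1_eq_of_input {i : Fin n} {r : ℕ} {x : Bool}
    (hx : c.input v coin i (r, 1) = some x) : (c i).view (r, 1) = {some x} := by
  rw [Config.input, LocalState.input_one] at hx
  exact midEst_eq_some hx

theorem exists_auxset_of_input (hc : GlobalInv t F v coin c) (htn : 3 * t < n) (hF : F.card ≤ t)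
    {i : Fin n} (hi : i ∉ F)
    {r : ℕ} {x : Bool} (hr : (r, 1) ∈ (c i).started) (hx : c.input v coin i (r, 1) = some x)
    {Q' : Finset (Fin n)} (hQ' : n - t ≤ Q'.card) :
    ∃ j ∈ Q', j ∉ F ∧ Msg.auxset r {some x} ∈ (c j).sent := by
  have h1 := (hc.started_iff hi r 1).1 hr
  have h2 := (hc.localInv i hi).view1 r h1.1 (by omega)
  rw [view1_eq_of_input hx] at h2
  exact hc.auxsetView_singleton htn hF hi h2 hQ'

theorem input_one_unique (hc : GlobalInv t F v coin c) (htn : 3 * t < n) (hF : F.card ≤ t)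
    {i j : Fin n} (hi : i ∉ F)
    (hj : j ∉ F) {r : ℕ} {x y : Bool} (hri : (r, 1) ∈ (c i).started)
    (hrj : (r, 1) ∈ (c j).started) (hx : c.input v coin i (r, 1) = some x)
    (hy : c.input v coin j (r, 1) = some y) : x = y := by
  obtain ⟨i', -, hi', h1⟩ :=
    hc.exists_auxset_of_input htn hF hi hri hx (Q' := Finset.univ) (by simp)
  obtain ⟨j', -, hj', h2⟩ :=
    hc.exists_auxset_of_input htn hF hj hrj hy (Q' := Finset.univ) (by simp)
  exact Option.some_injective _ (hc.auxset_unique htn hF hi' hj' h1 h2)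

/-- Binary elements of the view are inputs of non-faulty processes to the second broadcast, and
those cannot differ. Hence `caseNone` never occurs. -/
theorem view2_cases (hc : GlobalInv t F v coin c) (htn : 3 * t < n) (hF : F.card ≤ t)
    {i : Fin n} (hi : i ∉ F) {r : ℕ}
    (hr : 1 ≤ r) (hs : 11 * r + 8 ≤ (c i).stage) :
    (c i).view (r, 2) = {none} ∨
      ∃ w, (c i).view (r, 2) = {some w} ∨ (c i).view (r, 2) = {some w, none} := by
  have h1 := (hc.localInv i hi).view2 r hr hs
  obtain ⟨z, hz, -⟩ := hc.auxView_inter htn hF hi hi h1 h1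
  by_cases hV : ∃ w, some w ∈ (c i).view (r, 2)
  · right
    obtain ⟨w, hw⟩ := hV
    refine ⟨w, ?_⟩
    have h2 : ∀ x, some x ∈ (c i).view (r, 2) → x = w := by
      intro x hx
      obtain ⟨j, hj, h3, h4⟩ := hc.auxView_input hF hi h1 hw
      obtain ⟨k, hk, h5, h6⟩ := hc.auxView_input hF hi h1 hx
      exact hc.input_one_unique htn hF hk hj h5 h3 h6 h4
    by_cases hn : none ∈ (c i).view (r, 2)
    · right
      ext x
      cases x <;> grind
    · left
      ext x
      cases x <;> grind
  · left
    push Not at hV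
    ext x
    cases x <;> cases z <;> grind

theorem input_succ_of_mem (hc : GlobalInv t F v coin c) (htn : 3 * t < n) (hF : F.card ≤ t)
    {i : Fin n} (hi : i ∉ F) {r : ℕ}
    (hr : 1 ≤ r) (hs : 11 * r + 8 ≤ (c i).stage) {x : Bool} (hx : some x ∈ (c i).view (r, 2)) :
    c.input v coin i (r + 1, 0) = some x := by
  rw [Config.input, LocalState.input_zero_succ hr]
  rcases hc.view2_cases htn hF hi hr hs with h | ⟨w, h⟩
  · simp [h] at hx
  · have : x = w := by rcases h with h | h <;> simpa [h] using hx
    exact finalEst_of_mem_some (this ▸ h)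

theorem input_succ_cases (hc : GlobalInv t F v coin c) (htn : 3 * t < n) (hF : F.card ≤ t)
    {i : Fin n} (hi : i ∉ F) {r : ℕ}
    (hr : 1 ≤ r) (hs : 11 * r + 8 ≤ (c i).stage) :
    c.input v coin i (r + 1, 0) = some (coin r i) ∨
      ∃ x, some x ∈ (c i).view (r, 2) ∧ c.input v coin i (r + 1, 0) = some x := by
  rcases hc.view2_cases htn hF hi hr hs with h | ⟨w, h⟩
  · left
    rw [Config.input, LocalState.input_zero_succ hr, h, finalEst_bot]
  · have hw : some w ∈ (c i).view (r, 2) := by rcases h with h | h <;> simp [h]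
    exact Or.inr ⟨w, hw, hc.input_succ_of_mem htn hF hi hr hs hw⟩

/-- Used for liveness: ⊥ never enters the first broadcast, so only two values compete there. -/
theorem input_zero_eq_some (hc : GlobalInv t F v coin c) (htn : 3 * t < n) (hF : F.card ≤ t)
    {i : Fin n} (hi : i ∉ F) {r : ℕ}
    (hr : (r, 0) ∈ (c i).started) : ∃ b, c.input v coin i (r, 0) = some b := by
  have h1 := (hc.started_iff hi r 0).1 hr
  simp only [Fin.val_zero] at h1
  obtain ⟨r, rfl⟩ := Nat.exists_eq_add_of_le' h1.1
  rcases Nat.eq_zero_or_pos r with rfl | h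
  · exact ⟨v i, by simp [Config.input, LocalState.input]⟩
  · rcases hc.input_succ_cases htn hF hi h (by omega) with h | ⟨x, -, h⟩ <;> exact ⟨_, h⟩

/-! ### Unanimity -/

theorem auxView_eq_of_unanimous (hc : GlobalInv t F v coin c) (htn : 3 * t < n) (hF : F.card ≤ t)
    {τ : Tag} {x : Val}
    (h : ∀ j ∉ F, τ ∈ (c j).started → c.input v coin j τ = x) {i : Fin n} (hi : i ∉ F)
    {V : Set Val} (hV : (c i).AuxView t τ V) : V = {x} := by
  obtain ⟨z, hz, -⟩ := hc.auxView_inter htn hF hi hi hV hV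
  refine (Set.Nonempty.subset_singleton_iff ⟨z, hz⟩).1 fun y hy => ?_
  obtain ⟨j, hj, h1, h2⟩ := hc.auxView_input hF hi hV hy
  exact h2.symm.trans (h j hj h1)

/-- Only `b` can enter `bin (r, 0)`, so every `view (r, 1)` is {b}; the second broadcast is then
unanimous as well. -/
theorem view2_of_unanimous (hc : GlobalInv t F v coin c) (htn : 3 * t < n) (hF : F.card ≤ t)
    {r : ℕ} {b : Bool}
    (h : ∀ j ∉ F, (r, 0) ∈ (c j).started → c.input v coin j (r, 0) = some b) (hr : 1 ≤ r)
    {i : Fin n} (hi : i ∉ F) (hs : 11 * r + 8 ≤ (c i).stage) :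
    (c i).view (r, 2) = {some b} := by
  refine hc.auxView_eq_of_unanimous htn hF (fun j hj hjs => ?_) hi
    ((hc.localInv i hi).view2 r hr hs)
  have h1 := (hc.started_iff hj r 1).1 hjs
  have hV := (hc.localInv j hj).view1 r hr (by omega)
  rw [Config.input, LocalState.input_one]
  have : (c j).view (r, 1) = {some b} := by
    refine (hc.auxsetView_nonempty htn hF hj hV).subset_singleton_iff.1 fun x hx => ?_
    obtain ⟨Q, S, -, hm, h2⟩ := hV
    rw [h2] at hx
    obtain ⟨k, hk, hx⟩ := hx
    obtain ⟨k', hk', h3, h4⟩ := hc.bin_input hF hj ((hm k hk).2 hx)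
    exact h4.symm.trans (h k' hk' h3)
  rw [this, midEst_singleton]

theorem unanimous_succ (hc : GlobalInv t F v coin c) (htn : 3 * t < n) (hF : F.card ≤ t)
    {r : ℕ} {b : Bool} (hr : 1 ≤ r)
    (h : ∀ j ∉ F, (r, 0) ∈ (c j).started → c.input v coin j (r, 0) = some b) :
    ∀ j ∉ F, (r + 1, 0) ∈ (c j).started → c.input v coin j (r + 1, 0) = some b := by
  intro j hj hs
  have h1 := (hc.started_iff hj _ _).1 hs
  have h2 := hc.view2_of_unanimous htn hF h hr hj (by omega)
  exact hc.input_succ_of_mem htn hF hj hr (by omega) (by simp [h2])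

theorem unanimous_of_le (hc : GlobalInv t F v coin c) (htn : 3 * t < n) (hF : F.card ≤ t)
    {r r' : ℕ} {b : Bool} (hr : 1 ≤ r)
    (hrr : r ≤ r')
    (h : ∀ j ∉ F, (r, 0) ∈ (c j).started → c.input v coin j (r, 0) = some b) :
    ∀ j ∉ F, (r', 0) ∈ (c j).started → c.input v coin j (r', 0) = some b := by
  induction hrr with
  | refl => exact h
  | step h' ih => exact hc.unanimous_succ htn hF (hr.trans h') ih

/-- The decider's view is {b} and meets every other `view (r, 2)`, so every process that ends round
`r` adopts `b`. -/
theorem unanimous_of_decision (hc : GlobalInv t F v coin c) (htn : 3 * t < n) (hF : F.card ≤ t)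
    {r : ℕ} {b : Bool} {i : Fin n}
    (hi : i ∉ F) (hd : (c i).decision = some (r, b)) :
    ∀ j ∉ F, (r + 1, 0) ∈ (c j).started → c.input v coin j (r + 1, 0) = some b := by
  intro j hj hs
  have h1 := (hc.started_iff hj _ _).1 hs
  obtain ⟨hr, h2, h3⟩ := (hc.localInv i hi).decision r b hd
  obtain ⟨x, hx, hx'⟩ := hc.auxView_inter htn hF hi hj
    ((hc.localInv i hi).view2 r hr (by omega)) ((hc.localInv j hj).view2 r hr (by omega))
  rw [h3] at hx
  obtain rfl := hx
  exact hc.input_succ_of_mem htn hF hj hr (by omega) hx'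

theorem agreement (hc : GlobalInv t F v coin c) (htn : 3 * t < n) (hF : F.card ≤ t)
    {i j : Fin n} (hi : i ∉ F) (hj : j ∉ F)
    {r r' : ℕ} {b b' : Bool} (hd : (c i).decision = some (r, b))
    (hd' : (c j).decision = some (r', b')) : b = b' := by
  wlog hrr : r ≤ r' generalizing i j r r' b b'
  · exact (this hj hi hd' hd (by omega)).symm
  obtain ⟨hr, h1, h2⟩ := (hc.localInv i hi).decision r b hd
  obtain ⟨hr', h1', h2'⟩ := (hc.localInv j hj).decision r' b' hd'
  rcases hrr.eq_or_lt with rfl | hlt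
  · obtain ⟨x, hx, hx'⟩ := hc.auxView_inter htn hF hi hj
      ((hc.localInv i hi).view2 r hr (by omega)) ((hc.localInv j hj).view2 r hr (by omega))
    rw [h2] at hx
    rw [h2'] at hx'
    exact Option.some_injective _ (hx.symm.trans hx')
  · have h3 := hc.view2_of_unanimous htn hF
      (hc.unanimous_of_le htn hF (by omega) hlt (hc.unanimous_of_decision htn hF hi hd)) hr' hj
      (by omega)
    exact Option.some_injective _ (Set.singleton_injective (h3.symm.trans h2'))

theorem validity (hc : GlobalInv t F v coin c) (htn : 3 * t < n) (hF : F.card ≤ t)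
    {b : Bool} (hv : ∀ i ∉ F, v i = b)
    {i : Fin n} (hi : i ∉ F) {r : ℕ} {b' : Bool} (hd : (c i).decision = some (r, b')) :
    b' = b := by
  obtain ⟨hr, h1, h2⟩ := (hc.localInv i hi).decision r b' hd
  have h3 := hc.view2_of_unanimous htn hF (hc.unanimous_of_le htn hF (b := b) le_rfl hr
    fun j hj _ => by simp [Config.input, LocalState.input, hv j hj]) hr hi (by omega)
  exact Option.some_injective _ (Set.singleton_injective (h2.symm.trans h3))

/-- A process either takes the coin, which is `b`, or adopts a binary value of its view; the latter
is a non-faulty input of the second broadcast, hence `b` by `h`. -/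
theorem unanimous_of_coin (hc : GlobalInv t F v coin c) (htn : 3 * t < n) (hF : F.card ≤ t)
    {r : ℕ} (hr : 1 ≤ r) {b : Bool}
    (hcoin : ∀ i ∉ F, coin r i = b)
    (h : ∀ i ∉ F, (r, 1) ∈ (c i).started → ∀ w, c.input v coin i (r, 1) = some w → w = b) :
    ∀ j ∉ F, (r + 1, 0) ∈ (c j).started → c.input v coin j (r + 1, 0) = some b := by
  intro j hj hs
  have h1 := (hc.started_iff hj _ _).1 hs
  rcases hc.input_succ_cases htn hF hj hr (by omega) with h2 | ⟨x, h2, h3⟩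
  · rw [h2, hcoin j hj]
  · obtain ⟨k, hk, h4, h5⟩ :=
      hc.auxView_input hF hj ((hc.localInv j hj).view2 r hr (by omega)) h2
    rw [h3, h k hk h4 x h5]

theorem decided_of_unanimous (hc : GlobalInv t F v coin c) (htn : 3 * t < n) (hF : F.card ≤ t)
    {r : ℕ} {b : Bool} (hr : 1 ≤ r)
    (h : ∀ j ∉ F, (r, 0) ∈ (c j).started → c.input v coin j (r, 0) = some b)
    {i : Fin n} (hi : i ∉ F) (hs : 11 * r + 10 ≤ (c i).stage) :
    ∃ r' ≤ r, ∃ b', (c i).decision = some (r', b') :=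
  (hc.localInv i hi).decided r b hr hs (hc.view2_of_unanimous htn hF h hr hi (by omega))

/-- Once a process has obtained `view[r,2]`, the only binary value that can be an input of the second
SBV-Broadcast of round `r` is carried by an `AUXSET` message that has been sent already. -/
theorem exists_auxset_of_later_input (htn : 3 * t < n) (hF : F.card ≤ t)
    (hc : GlobalInv t F v coin c) (hc' : GlobalInv t F v coin c')
    (hx : ∀ i, Extends (c i) (c' i)) {i j : Fin n} (hi : i ∉ F) (hj : j ∉ F) {r : ℕ} (hr : 1 ≤ r)
    (hs : 11 * r + 8 ≤ (c i).stage) (hjs : (r, 1) ∈ (c' j).started) {w : Bool}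
    (hw : c'.input v coin j (r, 1) = some w) :
    ∃ k ∉ F, Msg.auxset r {some w} ∈ (c k).sent := by
  -- `Q` consists of the AUX senders behind the view of `i`. The process `k` found in it had sent
  -- its second AUX message before `c`, hence also its AUXSET of round `r`; since it sends only one,
  -- this is the AUXSET seen in `c'`.
  obtain ⟨Q, u, hQ, hm, -⟩ := (hc.localInv i hi).view2 r hr hs
  obtain ⟨k, hk, hkF, h1⟩ := hc'.exists_auxset_of_input htn hF hj hjs hw hQ
  have lk := hc.localInv k hkF
  have h2 : 11 * r + 6 + 1 ≤ (c k).stage :=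
    lk.aux_stage r 1 _ (hc.rcvd i hi k hkF _ (hm k hk).1)
  have h3 := lk.auxset_exists r hr (by omega)
  have h4 := (hc'.localInv k hkF).auxset_view r _ ((hx k).sent h3)
  rw [← (hc'.localInv k hkF).auxset_view r _ h1] at h4
  exact ⟨k, hkF, h4 ▸ h3⟩

end GlobalInv

end

/-! ### Liveness of fair executions -/

section

open Filter

variable {t : ℕ} {F : Finset (Fin n)} {v : Fin n → Bool} {coin : ℕ → Fin n → Bool}
  {X : ℕ → Config n} {a : ℕ → Action n}

namespace IsExecution

theorem eventually_mem_bin (h : IsExecution t F v coin X a) (hF : F.card ≤ t) {k : ℕ} {j : Fin n}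
    {τ : Tag} {x : Val} (hm : x ∈ (X k j).bin τ) : ∀ᶠ k in atTop, x ∈ (X k j).bin τ :=
  (eventually_ge_atTop k).mono fun _ hk => (h.extends hF hk j).bin τ hm

theorem eventually_rcvd (h : IsExecution t F v coin X a) (hF : F.card ≤ t)
    (hfair : IsFair t F coin X a) {i j : Fin n} (hi : i ∉ F) (hj : j ∉ F) {k : ℕ} {m : Msg}
    (hm : m ∈ (X k j).sent) : ∀ᶠ k in atTop, (j, m) ∈ (X k i).rcvd := by
  obtain ⟨k', hk'⟩ := hfair.delivery i hi j hj k m hm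
  exact (eventually_ge_atTop k').mono fun _ hk => (h.extends hF hk i).rcvd hk'

theorem eventually_receivedFrom (h : IsExecution t F v coin X a) (hF : F.card ≤ t)
    (hfair : IsFair t F coin X a) {i : Fin n} (hi : i ∉ F) {Q : Finset (Fin n)} {m : Msg}
    (hQ : ∀ j ∈ Q, j ∉ F ∧ ∃ k, m ∈ (X k j).sent) {q : ℕ} (hq : q ≤ Q.card) :
    ∀ᶠ k in atTop, (X k i).ReceivedFrom m q := by
  have : ∀ᶠ k in atTop, ∀ j ∈ Q, (j, m) ∈ (X k i).rcvd := by
    rw [Filter.eventually_all_finset]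
    intro j hj
    obtain ⟨hjF, k, hk⟩ := hQ j hj
    exact h.eventually_rcvd hF hfair hi hjF hk
  exact this.mono fun k hk => ⟨Q, hq, hk⟩

/-- If the message were never sent, the echo thread would remain enabled from some time on, and
fairness would make it run. -/
theorem eventually_echo (h : IsExecution t F v coin X a)
    (hfair : IsFair t F coin X a) {i : Fin n} (hi : i ∉ F) {τ : Tag} {x : Val}
    (hs : ∀ᶠ k in atTop, τ ∈ (X k i).started)
    (hr : ∀ᶠ k in atTop, (X k i).ReceivedFrom (.bval τ x) (t + 1)) :
    ∃ k, Msg.bval τ x ∈ (X k i).sent := by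
  by_contra! hn
  obtain ⟨k, hk⟩ := eventually_atTop.1 (hs.and hr)
  have hen : ∀ k' ≥ k, ∃ c, Step t F coin (X k') (.thread i (.bvEcho τ x)) c := fun k' hk' =>
    ⟨_, .thread _ i _ _ hi (.bvEcho _ τ x (hk k' hk').1 (hk k' hk').2 (hn k'))⟩
  obtain ⟨k', hk', h1 | h1⟩ := hfair.progress i hi _ k (hen k le_rfl)
  · have h2 := h.step k'
    rw [h1] at h2
    refine hn (k' + 1) ?_
    generalize X (k' + 1) = c at h2
    cases h2 with
    | thread i th l hi' hl =>
      cases hl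
      simp [LocalState.broadcast]
  · exact h1 (hen k' hk')

theorem eventually_deliver (h : IsExecution t F v coin X a) (hF : F.card ≤ t)
    (hfair : IsFair t F coin X a) {i : Fin n} (hi : i ∉ F) {τ : Tag} {x : Val}
    (hs : ∀ᶠ k in atTop, τ ∈ (X k i).started)
    (hr : ∀ᶠ k in atTop, (X k i).ReceivedFrom (.bval τ x) (2 * t + 1)) :
    ∀ᶠ k in atTop, x ∈ (X k i).bin τ := by
  suffices ∃ k, x ∈ (X k i).bin τ from this.elim fun k hk => h.eventually_mem_bin hF hk
  by_contra! hn
  obtain ⟨k, hk⟩ := eventually_atTop.1 (hs.and hr)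
  have hen : ∀ k' ≥ k, ∃ c, Step t F coin (X k') (.thread i (.bvDeliver τ x)) c := fun k' hk' =>
    ⟨_, .thread _ i _ _ hi (.bvDeliver _ τ x (hk k' hk').1 (hk k' hk').2 (hn k'))⟩
  obtain ⟨k', hk', h1 | h1⟩ := hfair.progress i hi _ k (hen k le_rfl)
  · have h2 := h.step k'
    rw [h1] at h2
    refine hn (k' + 1) ?_
    generalize X (k' + 1) = c at h2
    cases h2 with
    | thread i th l hi' hl =>
      cases hl
      simp
  · exact h1 (hen k' hk')

theorem card_compl_ge (hF : F.card ≤ t) : n - t ≤ Fᶜ.card := by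
  rw [Finset.card_compl, Fintype.card_fin]; omega

/-- The t + 1 senders make all non-faulty processes echo, and these are at least n - t ≥ 2t + 1. -/
theorem eventually_mem_bin_of_sent (h : IsExecution t F v coin X a) (htn : 3 * t < n)
    (hF : F.card ≤ t) (hfair : IsFair t F coin X a) {τ : Tag} {x : Val}
    (hs : ∀ i ∉ F, ∀ᶠ k in atTop, τ ∈ (X k i).started) {Q : Finset (Fin n)}
    (hQ : ∀ j ∈ Q, j ∉ F ∧ ∃ k, Msg.bval τ x ∈ (X k j).sent) (hcard : t + 1 ≤ Q.card)
    {i : Fin n} (hi : i ∉ F) : ∀ᶠ k in atTop, x ∈ (X k i).bin τ := by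
  have h1 : ∀ j ∈ Fᶜ, j ∉ F ∧ ∃ k, Msg.bval τ x ∈ (X k j).sent := fun j hj => by
    rw [Finset.mem_compl] at hj
    exact ⟨hj, h.eventually_echo hfair hj (hs j hj)
      (h.eventually_receivedFrom hF hfair hj hQ hcard)⟩
  have h2 := card_compl_ge (F := F) hF
  exact h.eventually_deliver hF hfair hi (hs i hi)
    (h.eventually_receivedFrom hF hfair hi h1 (by omega))

/-- Of the 2t + 1 senders behind a delivery, at least t + 1 are non-faulty and reach everybody. -/
theorem eventually_mem_bin_of_mem_bin (h : IsExecution t F v coin X a) (htn : 3 * t < n)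
    (hF : F.card ≤ t) (hfair : IsFair t F coin X a) {τ : Tag} {x : Val}
    (hs : ∀ i ∉ F, ∀ᶠ k in atTop, τ ∈ (X k i).started) {i j : Fin n} (hi : i ∉ F) (hj : j ∉ F)
    {k : ℕ} (hx : x ∈ (X k j).bin τ) : ∀ᶠ k in atTop, x ∈ (X k i).bin τ := by
  have hg := h.globalInv hF k
  obtain ⟨Q, hQ, hm⟩ := (hg.localInv j hj).bin_rcvd τ x hx
  have h1 := Finset.le_card_sdiff F Q
  refine h.eventually_mem_bin_of_sent htn hF hfair hs (Q := Q \ F) (fun j' hj' => ?_)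
    (by omega) hi
  rw [Finset.mem_sdiff] at hj'
  exact ⟨hj'.2, k, hg.rcvd j hj j' hj'.2 _ (hm j' hj'.1)⟩

/-- Pigeonhole: the at least 2t + 1 non-faulty processes have at most two different inputs (both
binary for `s = 0`; one binary value and ⊥ for `s = 1`), so some input is shared by t + 1 of them.
-/
theorem eventually_bin_nonempty (h : IsExecution t F v coin X a) (htn : 3 * t < n)
    (hF : F.card ≤ t) (hfair : IsFair t F coin X a) {r : ℕ} {s : Fin 2}
    (hs : ∀ i ∉ F, ∀ᶠ k in atTop, (r, s) ∈ (X k i).started) {i : Fin n} (hi : i ∉ F) :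
    ∀ᶠ k in atTop, ((X k i).bin (r, s)).Nonempty := by
  have h1 : ∀ᶠ k in atTop, ∀ i ∈ Fᶜ, (r, s) ∈ (X k i).started := by
    rw [Filter.eventually_all_finset]
    exact fun i hi => hs i (Finset.mem_compl.1 hi)
  obtain ⟨k, hk⟩ := h1.exists
  have hg := h.globalInv hF k
  have h2 : ∃ x y : Val, ∀ j ∈ Fᶜ,
      (X k).input v coin j (r, s) = x ∨ (X k).input v coin j (r, s) = y := by
    obtain rfl | rfl : s = 0 ∨ s = 1 := by omega
    · refine ⟨some true, some false, fun j hj => ?_⟩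
      obtain ⟨b, hb⟩ := hg.input_zero_eq_some htn hF (Finset.mem_compl.1 hj) (hk j hj)
      cases b <;> simp [hb]
    · by_cases hw : ∃ j ∈ Fᶜ, ∃ w : Bool, (X k).input v coin j (r, 1) = some w
      · obtain ⟨j, hj, w, hw⟩ := hw
        refine ⟨some w, none, fun j' hj' => ?_⟩
        cases hw' : (X k).input v coin j' (r, 1) with
        | none => exact Or.inr rfl
        | some w' =>
          left
          rw [hg.input_one_unique htn hF (Finset.mem_compl.1 hj') (Finset.mem_compl.1 hj)
            (hk j' hj') (hk j hj) hw' hw]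
      · push Not at hw
        refine ⟨none, none, fun j hj => Or.inl ?_⟩
        cases hw' : (X k).input v coin j (r, 1) with
        | none => rfl
        | some w' => exact absurd hw' (hw j hj w')
  obtain ⟨x, y, hxy⟩ := h2
  have key : ∀ z, t + 1 ≤ (Fᶜ.filter fun j => (X k).input v coin j (r, s) = z).card →
      ∀ᶠ k in atTop, ((X k i).bin (r, s)).Nonempty := fun z hz =>
    (h.eventually_mem_bin_of_sent htn hF hfair hs (x := z) (fun j hj => by
      rw [Finset.mem_filter] at hj
      obtain ⟨hj, rfl⟩ := hj
      have hj' := Finset.mem_compl.1 hj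
      exact ⟨hj', k, (hg.localInv j hj').bval_sent _ (hk j hj)⟩) hz hi).mono fun k hk => ⟨z, hk⟩
  have h3 := card_compl_ge (F := F) hF
  have h4 := Finset.card_union_le (Fᶜ.filter fun j => (X k).input v coin j (r, s) = x)
    (Fᶜ.filter fun j => (X k).input v coin j (r, s) = y)
  rw [← Finset.filter_or, Finset.filter_true_of_mem hxy] at h4
  by_cases hx : t + 1 ≤ (Fᶜ.filter fun j => (X k).input v coin j (r, s) = x).card
  · exact key x hx
  · exact key y (by omega)

theorem _root_.BBC.LocalState.AuxView.subset_bin {l : LocalState n} {τ : Tag} {V : Set Val}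
    (hV : l.AuxView t τ V) : V ⊆ l.bin τ := by
  obtain ⟨Q, w, -, hm, rfl⟩ := hV
  rintro _ ⟨j, hj, rfl⟩
  exact (hm j hj).2

theorem eventually_started (h : IsExecution t F v coin X a) (hF : F.card ≤ t) {r : ℕ} {s : Fin 2}
    (hr : 1 ≤ r) {q : ℕ} (hq : 11 * r + 6 * s ≤ q)
    (hs : ∀ i ∉ F, ∀ᶠ k in atTop, q ≤ (X k i).stage) :
    ∀ i ∉ F, ∀ᶠ k in atTop, (r, s) ∈ (X k i).started := fun i hi =>
  (hs i hi).mono fun k hk => ((h.globalInv hF k).started_iff hi r s).2 ⟨hr, hq.trans hk⟩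

/-- The non-faulty processes form a quorum: their AUX messages arrive, and the values carried spread
from the sender's `bin` to all others. -/
theorem eventually_auxView (h : IsExecution t F v coin X a) (htn : 3 * t < n)
    (hF : F.card ≤ t) (hfair : IsFair t F coin X a) {r : ℕ} {s : Fin 2} (hr : 1 ≤ r)
    (hs : ∀ i ∉ F, ∀ᶠ k in atTop, 11 * r + 6 * s.val + 1 ≤ (X k i).stage) {i : Fin n}
    (hi : i ∉ F) : ∀ᶠ k in atTop, ∃ V, (X k i).AuxView t (r, s) V := by
  have hst := h.eventually_started hF hr (s := s) (Nat.le_succ _) hs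
  have h1 : ∀ j, ∃ w, j ∉ F → ∃ k, Msg.aux (r, s) w ∈ (X k j).sent := by
    intro j
    by_cases hj : j ∈ F
    · exact ⟨none, fun h => absurd hj h⟩
    · obtain ⟨k, hk⟩ := (hs j hj).exists
      obtain ⟨w, hw⟩ := ((h.globalInv hF k).localInv j hj).aux_exists r s hr hk
      exact ⟨w, fun _ => ⟨k, hw⟩⟩
  choose w hw using h1
  have h2 : ∀ᶠ k in atTop, ∀ j ∈ Fᶜ,
      (j, Msg.aux (r, s) (w j)) ∈ (X k i).rcvd ∧ w j ∈ (X k i).bin (r, s) := by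
    rw [Filter.eventually_all_finset]
    intro j hj
    rw [Finset.mem_compl] at hj
    obtain ⟨k, hk⟩ := hw j hj
    exact (h.eventually_rcvd hF hfair hi hj hk).and (h.eventually_mem_bin_of_mem_bin htn hF hfair
      hst hi hj (((h.globalInv hF k).localInv j hj).aux_bin _ _ hk))
  exact h2.mono fun k hk => ⟨_, Fᶜ, w, card_compl_ge hF, hk, rfl⟩

theorem eventually_auxsetView (h : IsExecution t F v coin X a) (htn : 3 * t < n)
    (hF : F.card ≤ t) (hfair : IsFair t F coin X a) {r : ℕ} (hr : 1 ≤ r)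
    (hs : ∀ i ∉ F, ∀ᶠ k in atTop, 11 * r + 3 ≤ (X k i).stage) {i : Fin n}
    (hi : i ∉ F) : ∀ᶠ k in atTop, ∃ V, (X k i).AuxsetView t r V := by
  have hst := h.eventually_started hF hr (s := 0) (by simp) hs
  have h1 : ∀ j, ∃ S, j ∉ F → ∃ k, Msg.auxset r S ∈ (X k j).sent ∧ S ⊆ (X k j).bin (r, 0) := by
    intro j
    by_cases hj : j ∈ F
    · exact ⟨∅, fun h => absurd hj h⟩
    · obtain ⟨k, hk⟩ := (hs j hj).exists
      have hl := (h.globalInv hF k).localInv j hj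
      exact ⟨_, fun _ => ⟨k, hl.auxset_exists r hr hk, (hl.view0 r hr (by omega)).subset_bin⟩⟩
  choose S hS using h1
  have h2 : ∀ᶠ k in atTop, ∀ j ∈ Fᶜ,
      (j, Msg.auxset r (S j)) ∈ (X k i).rcvd ∧ S j ⊆ (X k i).bin (r, 0) := by
    rw [Filter.eventually_all_finset]
    intro j hj
    rw [Finset.mem_compl] at hj
    obtain ⟨k, hk, hk'⟩ := hS j hj
    refine (h.eventually_rcvd hF hfair hi hj hk).and ?_
    -- `Val` is finite, so finitely many eventual memberships hold simultaneously from some time on.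
    have : ∀ᶠ k in atTop, ∀ x : Val, x ∈ S j → x ∈ (X k i).bin (r, 0) := by
      rw [Filter.eventually_all]
      intro x
      rw [Filter.eventually_imp_distrib_left]
      exact fun hx => h.eventually_mem_bin_of_mem_bin htn hF hfair hst hi hj (hk' hx)
    exact this
  exact h2.mono fun k hk => ⟨_, Fᶜ, S, card_compl_ge hF, hk, rfl⟩

theorem eventually_stage_succ (h : IsExecution t F v coin X a) (hF : F.card ≤ t)
    (hfair : IsFair t F coin X a) {i : Fin n} (hi : i ∉ F) {q : ℕ}
    (hq : ∀ᶠ k in atTop, q ≤ (X k i).stage)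
    (hen : ∀ᶠ k in atTop, (X k i).stage = q →
      ∃ l, ThreadStep t (fun r => coin r i) .main (X k i) l) :
    ∀ᶠ k in atTop, q + 1 ≤ (X k i).stage := by
  suffices ∃ k, q + 1 ≤ (X k i).stage from this.elim fun k hk =>
    (eventually_ge_atTop k).mono fun _ hk' => hk.trans (h.extends hF hk' i).stage
  by_contra! hn
  obtain ⟨k, hk⟩ := eventually_atTop.1 (hq.and hen)
  have hst : ∀ k' ≥ k, (X k' i).stage = q := fun k' hk' =>
    le_antisymm (Nat.lt_succ_iff.1 (hn k')) (hk k' hk').1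
  have hen' : ∀ k' ≥ k, ∃ c, Step t F coin (X k') (.thread i .main) c := fun k' hk' => by
    obtain ⟨l, hl⟩ := (hk k' hk').2 (hst k' hk')
    exact ⟨_, .thread _ i _ l hi hl⟩
  obtain ⟨k', hk', h1 | h1⟩ := hfair.progress i hi _ k (hen' k le_rfl)
  · have h2 := h.step k'
    rw [h1] at h2
    have h3 := hst k' hk'
    have h4 := hst (k' + 1) (by omega)
    generalize X (k' + 1) = c at h2 h4
    cases h2 with
    | thread i th l hi' hl =>
      rw [Function.update_self, hl.stage_main] at h4
      omega
  · exact h1 (hen' k' hk')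

/-- In a fair execution every non-faulty process takes infinitely many steps of its main thread. -/
theorem eventually_stage_ge (h : IsExecution t F v coin X a) (htn : 3 * t < n)
    (hF : F.card ≤ t) (hfair : IsFair t F coin X a) (q : ℕ) :
    ∀ i ∉ F, ∀ᶠ k in atTop, q ≤ (X k i).stage := by
  induction q with
  | zero => exact fun i _ => Eventually.of_forall fun k => Nat.zero_le _
  | succ q ih =>
    intro i hi
    refine h.eventually_stage_succ hF hfair hi (ih i hi) ?_
    have h1 : ∀ᶠ k in atTop, ∀ s : Fin 2, (1 ≤ q / 11 ∧ 11 * (q / 11) + 6 * s.val = q) →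
        ((X k i).bin (q / 11, s)).Nonempty := by
      simp only [Filter.eventually_all]
      exact fun s hs => h.eventually_bin_nonempty htn hF hfair
        (h.eventually_started hF hs.1 hs.2.le ih) hi
    have h2 : ∀ᶠ k in atTop, ∀ s : Fin 2, (1 ≤ q / 11 ∧ 11 * (q / 11) + 6 * s.val + 1 = q) →
        ∃ V, (X k i).AuxView t (q / 11, s) V := by
      simp only [Filter.eventually_all]
      intro s hs
      refine h.eventually_auxView htn hF hfair hs.1 ?_ hi
      rw [hs.2]
      exact ih
    have h3 : ∀ᶠ k in atTop, (1 ≤ q / 11 ∧ 11 * (q / 11) + 3 = q) →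
        ∃ V, (X k i).AuxsetView t (q / 11) V := by
      rw [Filter.eventually_imp_distrib_left]
      intro hs
      refine h.eventually_auxsetView htn hF hfair hs.1 ?_ hi
      rw [hs.2]
      exact ih
    filter_upwards [h1, h2, h3] with k h1 h2 h3 hq
    have hr := ((h.globalInv hF k).localInv i hi).round_pos
    generalize X k i = l at h1 h2 h3 hq hr
    have h4 : l.round = q / 11 := by
      have := l.pc.idx_le
      rw [LocalState.stage] at hq
      omega
    rw [← h4] at h1 h2 h3
    rw [LocalState.stage] at hq
    cases hpc : l.pc with
    | roundStart => exact ⟨_, .roundStart l hpc⟩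
    | sbvAux s =>
      obtain ⟨w, hw⟩ := h1 s ⟨hr (by simp [hpc]), by simpa [hpc, add_assoc] using hq⟩
      exact ⟨_, .sbvAux l s w hpc hw⟩
    | sbvReturn s =>
      obtain ⟨V, hV⟩ := h2 s ⟨hr (by simp [hpc]), by simpa [hpc, add_assoc] using hq⟩
      exact ⟨_, .sbvReturn l s V hpc hV⟩
    | sendAuxset => exact ⟨_, .sendAuxset l hpc⟩
    | waitAuxset =>
      obtain ⟨V, hV⟩ := h3 ⟨hr (by simp [hpc]), by simpa [hpc, add_assoc] using hq⟩
      exact ⟨_, .waitAuxset l V hpc hV⟩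
    | setEst =>
      by_cases hV : ∃ w, l.view (l.round, 1) = {w}
      · obtain ⟨w, hw⟩ := hV
        exact ⟨_, .setEstSingle l w hpc hw⟩
      · push Not at hV
        exact ⟨_, .setEstBot l hpc hV⟩
    | secondSbv => exact ⟨_, .secondSbv l hpc⟩
    | callRandom => exact ⟨_, .callRandom l hpc⟩
    | finalCase =>
      by_cases hV1 : ∃ w : Bool, l.view (l.round, 2) = {some w}
      · exact hV1.elim fun w hw => ⟨_, .caseDecide l w hpc hw⟩
      by_cases hV2 : ∃ w : Bool, l.view (l.round, 2) = {some w, none}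
      · exact hV2.elim fun w hw => ⟨_, .caseAdopt l w hpc hw⟩
      by_cases hV3 : l.view (l.round, 2) = {none}
      · exact ⟨_, .caseCoin l hpc hV3⟩
      push Not at hV1 hV2
      exact ⟨_, .caseNone l hpc hV1 hV2 hV3⟩

end IsExecution

end

/-! ### Favorable rounds -/

/-- Some non-faulty process has returned from the second SBV-Broadcast of round `r`. -/
def Ready (F : Finset (Fin n)) (r : ℕ) (c : Config n) : Prop :=
  ∃ i ∉ F, 11 * r + 8 ≤ (c i).stage

open Classical in
/-- The value that the coin of round `r` has to output for the estimates to become equal. -/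
noncomputable def candidate (F : Finset (Fin n)) (r : ℕ) (c : Config n) : Bool :=
  decide (∃ j ∉ F, Msg.auxset r {some true} ∈ (c j).sent)

variable {Ω : Type*}

/-- The event that `Ready F r` becomes true at time `k`. -/
def firstReady (F : Finset (Fin n)) (X : ℕ → Ω → Config n) (r k : ℕ) : Set Ω :=
  {ω | Ready F r (X k ω) ∧ ∀ k' < k, ¬ Ready F r (X k' ω)}

/-- The event that the coin of round `r` outputs the candidate at all non-faulty processes. -/
def favorable (F : Finset (Fin n)) (coin : Ω → ℕ → Fin n → Bool) (X : ℕ → Ω → Config n) (r : ℕ) :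
    Set Ω :=
  {ω | ∃ k, ω ∈ firstReady F X r k ∧ ω ∈ CoinAgrees F coin r (candidate F r (X k ω))}

/-- The event that none of the rounds `1, ..., m` is favorable. -/
def unfavorableUpTo (F : Finset (Fin n)) (coin : Ω → ℕ → Fin n → Bool) (X : ℕ → Ω → Config n)
    (m : ℕ) : Set Ω :=
  {ω | ∀ r, 1 ≤ r → r ≤ m → ω ∉ favorable F coin X r}

theorem firstReady_unique {F : Finset (Fin n)} {X : ℕ → Ω → Config n} {r k k' : ℕ} {ω : Ω}
    (h : ω ∈ firstReady F X r k) (h' : ω ∈ firstReady F X r k') : k = k' := by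
  by_contra hne
  rcases Nat.lt_or_gt_of_ne hne with hlt | hlt
  · exact h'.2 k hlt h.1
  · exact h.2 k' hlt h'.1

theorem exists_firstReady {F : Finset (Fin n)} {X : ℕ → Ω → Config n} {r k : ℕ} {ω : Ω}
    (h : Ready F r (X k ω)) : ∃ k' ≤ k, ω ∈ firstReady F X r k' := by
  classical
  have h' : ∃ k, Ready F r (X k ω) := ⟨k, h⟩
  exact ⟨Nat.find h', Nat.find_min' h' h, Nat.find_spec h', fun _ hk => Nat.find_min h' hk⟩

section

variable {t : ℕ} {F : Finset (Fin n)} {v : Fin n → Bool}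

theorem Step.stage_le {coin : ℕ → Fin n → Bool} {c c' : Config n} {a : Action n}
    (h : Step t F coin c a c') (i : Fin n) : (c' i).stage ≤ (c i).stage + 1 := by
  cases h with
  | thread j th l hj hl =>
    by_cases hij : i = j
    · subst hij
      rw [Function.update_self]
      cases th
      · exact hl.stage_main.le
      · cases hl; exact Nat.le_succ _
      · cases hl; exact Nat.le_succ _
    · simp [hij]
  | recv j k m hj =>
    by_cases hij : i = j
    · subst hij; simp [LocalState.stage]
    · simp [hij]
  | idle => exact Nat.le_succ _

/-- Calling `random()` in round `r` leads to stage 11 r + 9, and stages grow by at most one per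
instant, so readiness holds at least one instant before the coin is revealed. -/
theorem IsExecution.not_revealed {coin : ℕ → Fin n → Bool} {X : ℕ → Config n} {a : ℕ → Action n}
    (h : IsExecution t F v coin X a) (hF : F.card ≤ t) {r k : ℕ}
    (hk : ∀ k' < k, ¬ Ready F r (X k')) : ¬ Revealed F r (X k) := by
  rintro ⟨i, hi, hr⟩
  have h1 := (((h.globalInv hF k).localInv i hi).coinCalls r).1 hr
  cases k with
  | zero =>
    rw [h.init] at h1
    simp [initConfig, LocalState.init, LocalState.stage] at h1
    omega
  | succ k =>
    have h2 := (h.step k).stage_le i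
    exact hk k (Nat.lt_succ_self k) ⟨i, hi, by omega⟩

/-- Makes the coins of earlier rounds known to the adversary when round `r` becomes ready. -/
theorem IsExecution.revealed_of_ready {coin : ℕ → Fin n → Bool} {X : ℕ → Config n}
    {a : ℕ → Action n} (h : IsExecution t F v coin X a) (hF : F.card ≤ t) {r r' k : ℕ}
    (hr' : 1 ≤ r') (hr : r' < r) (hk : Ready F r (X k)) : Revealed F r' (X k) := by
  obtain ⟨i, hi, hs⟩ := hk
  exact ⟨i, hi, (((h.globalInv hF k).localInv i hi).coinCalls r').2 ⟨hr', by omega⟩⟩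

/-- If the coin agrees with the candidate in round `r`, all processes decide by round `r + 1`. -/
theorem IsExecution.decision_of_candidate {coin : ℕ → Fin n → Bool} {X : ℕ → Config n}
    {a : ℕ → Action n} (h : IsExecution t F v coin X a) (htn : 3 * t < n) (hF : F.card ≤ t)
    (hfair : IsFair t F coin X a) {r k : ℕ} (hr : 1 ≤ r) (hk : Ready F r (X k))
    (hcoin : ∀ i ∉ F, coin r i = candidate F r (X k)) {i : Fin n} (hi : i ∉ F) :
    ∃ k' r' b, (X k' i).decision = some (r', b) ∧ r' ≤ r + 1 := by
  obtain ⟨k', hk', hs⟩ := ((Filter.eventually_ge_atTop k).and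
    (h.eventually_stage_ge htn hF hfair (11 * (r + 1) + 10) i hi)).exists
  have hg := h.globalInv hF k
  have hg' := h.globalInv hF k'
  have key := hg'.unanimous_of_coin htn hF hr hcoin fun j hj hjs w hw => by
    obtain ⟨i', hi', hs'⟩ := hk
    obtain ⟨m, hm, hmw⟩ := GlobalInv.exists_auxset_of_later_input htn hF hg hg'
      (fun i => h.extends hF hk' i) hi' hj hr hs' hjs hw
    -- If {0} was sent, `auxset_unique` excludes {1} and the candidate is `false`. The value `false`
    -- is also the default when no singleton was sent, where no binary `w` exists.
    cases w with
    | true => simpa [candidate] using ⟨m, hm, hmw⟩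
    | false =>
      refine Eq.symm ?_
      rw [candidate, decide_eq_false_iff_not]
      rintro ⟨m', hm', hmw'⟩
      simpa using hg.auxset_unique htn hF hm hm' hmw hmw'
  obtain ⟨r', hr', b, hb⟩ := hg'.decided_of_unanimous htn hF (by omega) key hi hs
  exact ⟨k', r', b, hb, hr'⟩

theorem decisionRound_le {X : ℕ → Config n} {i : Fin n} {k r : ℕ} {b : Bool}
    (h : (X k i).decision = some (r, b)) : decisionRound X i ≤ r :=
  iInf_le_of_le k (iInf_le_of_le r (iInf_le_of_le b (iInf_le_of_le h le_rfl)))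

theorem exists_decides_of_decisionRound_lt_top {X : ℕ → Config n} {i : Fin n}
    (h : decisionRound X i < ⊤) : ∃ b, Decides X i b := by
  simp only [decisionRound, iInf_lt_iff] at h
  obtain ⟨k, r, b, hb, -⟩ := h
  exact ⟨b, k, r, hb⟩

end

/-! ### Probability of favorable rounds and the expected decision round -/

section

variable [MeasurableSpace Ω] {μ : Measure Ω}
  {𝓕 : Filtration ℕ (inferInstance : MeasurableSpace Ω)} {t : ℕ} {F : Finset (Fin n)}
  {v : Fin n → Bool} {d : ℝ} {coin : Ω → ℕ → Fin n → Bool} {X : ℕ → Ω → Config n}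
  {a : ℕ → Ω → Action n}

namespace IsRandomExecution

theorem measurableSet_coinAgrees (hX : IsRandomExecution μ 𝓕 t F v d coin X a) (r : ℕ) (b : Bool) :
    MeasurableSet (CoinAgrees F coin r b) := by
  have : CoinAgrees F coin r b = ⋂ i, ⋂ (_ : i ∉ F), (fun ω => coin ω r i) ⁻¹' {b} := by
    ext ω; simp [CoinAgrees]
  rw [this]
  exact MeasurableSet.iInter fun i => MeasurableSet.iInter fun _ =>
    hX.commonCoin.measurable r i (measurableSet_singleton b)

theorem measurableSet_firstReady (hX : IsRandomExecution μ 𝓕 t F v d coin X a) (r k : ℕ) :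
    MeasurableSet[𝓕 k] (firstReady F X r k) := by
  have : firstReady F X r k =
      X k ⁻¹' {c | Ready F r c} ∩ ⋂ k', ⋂ (_ : k' < k), X k' ⁻¹' {c | ¬ Ready F r c} := by
    ext ω; simp [firstReady]
  rw [this]
  exact (hX.adapted k _).inter (MeasurableSet.iInter fun k' => MeasurableSet.iInter fun hk' =>
    𝓕.mono hk'.le _ (hX.adapted k' _))

theorem measurableSet_firstReady_candidate (hX : IsRandomExecution μ 𝓕 t F v d coin X a)
    (r k : ℕ) (b : Bool) :
    MeasurableSet[𝓕 k] (firstReady F X r k ∩ {ω | candidate F r (X k ω) = b}) :=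
  (hX.measurableSet_firstReady r k).inter (hX.adapted k {c | candidate F r c = b})

theorem measurableSet_favorable (hX : IsRandomExecution μ 𝓕 t F v d coin X a) (r : ℕ) :
    MeasurableSet (favorable F coin X r) := by
  have : favorable F coin X r = ⋃ k, ⋃ b,
      (firstReady F X r k ∩ {ω | candidate F r (X k ω) = b}) ∩ CoinAgrees F coin r b := by
    ext ω; simp [favorable, and_assoc]
  rw [this]
  exact MeasurableSet.iUnion fun k => MeasurableSet.iUnion fun b =>
    (𝓕.le k _ (hX.measurableSet_firstReady_candidate r k b)).inter
      (hX.measurableSet_coinAgrees r b)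

theorem measurableSet_unfavorableUpTo (hX : IsRandomExecution μ 𝓕 t F v d coin X a) (m : ℕ) :
    MeasurableSet (unfavorableUpTo F coin X m) := by
  have : unfavorableUpTo F coin X m =
      ⋂ r, ⋂ (_ : 1 ≤ r), ⋂ (_ : r ≤ m), (favorable F coin X r)ᶜ := by
    ext ω; simp [unfavorableUpTo]
  rw [this]
  exact MeasurableSet.iInter fun r => MeasurableSet.iInter fun _ => MeasurableSet.iInter fun _ =>
    (hX.measurableSet_favorable r).compl

/-- Coin outcomes are measurable at time `k` only where they are revealed. When round `r` is ready,
the coin of `r'` is revealed and round `r'` became ready no later than `k`. -/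
theorem measurableSet_firstReady_inter_favorable (hX : IsRandomExecution μ 𝓕 t F v d coin X a)
    (hF : F.card ≤ t) {r r' : ℕ} (hr' : 1 ≤ r') (hr : r' < r) (k : ℕ) :
    MeasurableSet[𝓕 k] (firstReady F X r k ∩ favorable F coin X r') := by
  have : firstReady F X r k ∩ favorable F coin X r' = ⋃ k', ⋃ (_ : k' ≤ k), ⋃ b,
      (firstReady F X r k ∩ (firstReady F X r' k' ∩ {ω | candidate F r' (X k' ω) = b})) ∩
        ({ω | Revealed F r' (X k ω)} ∩ CoinAgrees F coin r' b) := by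
    ext ω
    simp only [Set.mem_inter_iff, Set.mem_iUnion, Set.mem_ofPred_eq, favorable]
    constructor
    · rintro ⟨h1, k', h2, h3⟩
      have h4 : Ready F r' (X k ω) := h1.1.imp fun i hi => ⟨hi.1, by have := hi.2; omega⟩
      obtain ⟨k'', hk'', h5⟩ := exists_firstReady h4
      obtain rfl := firstReady_unique h2 h5
      exact ⟨k', hk'', _, ⟨h1, h2, rfl⟩,
        (hX.execution ω).revealed_of_ready hF hr' hr h1.1, h3⟩
    · rintro ⟨k', hk', b, ⟨h1, h2, rfl⟩, h3, h4⟩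
      exact ⟨h1, k', h2, h4⟩
  rw [this]
  exact MeasurableSet.iUnion fun k' => MeasurableSet.iUnion fun hk' => MeasurableSet.iUnion fun b =>
    ((hX.measurableSet_firstReady r k).inter
      (𝓕.mono hk' _ (hX.measurableSet_firstReady_candidate r' k' b))).inter
      (hX.commonCoin.revealed r' b k)

theorem measurableSet_firstReady_inter_unfavorableUpTo
    (hX : IsRandomExecution μ 𝓕 t F v d coin X a) (hF : F.card ≤ t) (m k : ℕ) :
    MeasurableSet[𝓕 k] (firstReady F X (m + 1) k ∩ unfavorableUpTo F coin X m) := by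
  have : firstReady F X (m + 1) k ∩ unfavorableUpTo F coin X m = firstReady F X (m + 1) k \
      ⋃ r, ⋃ (_ : 1 ≤ r), ⋃ (_ : r ≤ m), firstReady F X (m + 1) k ∩ favorable F coin X r := by
    ext ω
    simp only [unfavorableUpTo, Set.mem_inter_iff, Set.mem_sdiff, Set.mem_iUnion,
      Set.mem_ofPred_eq]
    grind
  rw [this]
  exact (hX.measurableSet_firstReady _ k).diff (MeasurableSet.iUnion fun r =>
    MeasurableSet.iUnion fun h1 => MeasurableSet.iUnion fun h2 =>
      hX.measurableSet_firstReady_inter_favorable hF h1 (Nat.lt_succ_of_le h2) k)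

/-- `A` is split by the value of the candidate, which is known at time `k`. On each half the
favorable event prescribes a fixed output of a coin not yet revealed, so unpredictability gives 1/d.
-/
theorem measureReal_inter_favorable [IsProbabilityMeasure μ]
    (hX : IsRandomExecution μ 𝓕 t F v d coin X a)
    (hF : F.card ≤ t) {r k : ℕ} {A : Set Ω} (hA : MeasurableSet[𝓕 k] A)
    (hAr : A ⊆ firstReady F X r k) :
    μ.real (A ∩ favorable F coin X r) = μ.real A / d := by
  let C : Bool → Set Ω := fun b => {ω | candidate F r (X k ω) = b}
  have hC : ∀ b, MeasurableSet[𝓕 k] (C b) := fun b => hX.adapted k {c | candidate F r c = b}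
  have hCt : C false = (C true)ᶜ := by ext ω; simp [C]
  have h1 : ∀ b, μ.real (A ∩ favorable F coin X r ∩ C b) = μ.real (A ∩ C b) / d := by
    intro b
    rw [← hX.commonCoin.unpredictable r b k (A ∩ C b) (hA.inter (hC b))
      fun ω hω => (hX.execution ω).not_revealed hF (hAr hω.1).2]
    congr 1
    ext ω
    constructor
    · rintro ⟨⟨h2, k', h3, h4⟩, h5⟩
      obtain rfl := firstReady_unique h3 (hAr h2)
      exact ⟨⟨h2, h5⟩, (h5 : _ = b) ▸ h4⟩
    · rintro ⟨⟨h2, h5⟩, h4⟩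
      exact ⟨⟨h2, k, hAr h2, (h5 : _ = b).symm ▸ h4⟩, h5⟩
  have h2 : ∀ B : Set Ω, μ.real (B ∩ C true) + μ.real (B ∩ C false) = μ.real B := fun B => by
    rw [hCt, ← Set.sdiff_eq]
    exact measureReal_inter_add_sdiff (𝓕.le k _ (hC true))
  rw [← h2, h1, h1, ← add_div, h2]

/-- Every round is eventually reached. -/
theorem ae_exists_firstReady (hX : IsRandomExecution μ 𝓕 t F v d coin X a) (htn : 3 * t < n)
    (hF : F.card ≤ t) (r : ℕ) : ∀ᵐ ω ∂μ, ∃ k, ω ∈ firstReady F X r k := by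
  filter_upwards [hX.fair] with ω hω
  obtain ⟨i, -, hi⟩ := exists_notMem_of_lt_card (Q := Finset.univ) hF (by simp; omega)
  obtain ⟨k, hk⟩ := ((hX.execution ω).eventually_stage_ge htn hF hω (11 * r + 8) i hi).exists
  obtain ⟨k', -, hk'⟩ := exists_firstReady (X := X) (ω := ω) ⟨i, hi, hk⟩
  exact ⟨k', hk'⟩

/-- The events `firstReady F X r k` partition Ω up to a null set, so the random time of readiness
can be replaced by fixed times. -/
theorem measure_eq_tsum_firstReady (hX : IsRandomExecution μ 𝓕 t F v d coin X a)
    (htn : 3 * t < n) (hF : F.card ≤ t) (r : ℕ) {A : Set Ω} (hA : MeasurableSet A) :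
    μ A = ∑' k, μ (firstReady F X r k ∩ A) := by
  rw [← measure_iUnion]
  · refine measure_congr ?_
    filter_upwards [hX.ae_exists_firstReady htn hF r] with ω hω
    refine propext ⟨fun h => ?_, fun h => ?_⟩
    · obtain ⟨k, hk⟩ := hω
      exact Set.mem_iUnion.2 ⟨k, hk, h⟩
    · obtain ⟨k, hk⟩ := Set.mem_iUnion.1 h
      exact hk.2
  · intro k k' hk
    refine Set.disjoint_left.2 fun ω h h' => hk (firstReady_unique h.1 h'.1)
  · exact fun k => (𝓕.le k _ (hX.measurableSet_firstReady r k)).inter hA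

theorem measure_unfavorableUpTo_succ [IsProbabilityMeasure μ]
    (hX : IsRandomExecution μ 𝓕 t F v d coin X a)
    (htn : 3 * t < n) (hF : F.card ≤ t) (hd : 1 ≤ d) (m : ℕ) :
    μ (unfavorableUpTo F coin X (m + 1)) =
      ENNReal.ofReal (1 - 1 / d) * μ (unfavorableUpTo F coin X m) := by
  rw [hX.measure_eq_tsum_firstReady htn hF (m + 1) (hX.measurableSet_unfavorableUpTo (m + 1)),
    hX.measure_eq_tsum_firstReady htn hF (m + 1) (hX.measurableSet_unfavorableUpTo m),
    ← ENNReal.tsum_mul_left]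
  congr 1
  ext1 k
  -- On this slice the history of rounds 1, ..., m is known at time `k`, and a fraction 1/d of it is
  -- favorable in round m + 1.
  set A := firstReady F X (m + 1) k ∩ unfavorableUpTo F coin X m with hA
  have h1 : firstReady F X (m + 1) k ∩ unfavorableUpTo F coin X (m + 1) =
      A \ favorable F coin X (m + 1) := by
    ext ω
    simp only [hA, unfavorableUpTo, Set.mem_inter_iff, Set.mem_sdiff, Set.mem_ofPred_eq]
    constructor
    · exact fun h => ⟨⟨h.1, fun r h2 h3 => h.2 r h2 (by omega)⟩, h.2 _ (by omega) le_rfl⟩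
    · rintro ⟨⟨h2, h3⟩, h4⟩
      refine ⟨h2, fun r h5 h6 => ?_⟩
      rcases Nat.le_succ_iff.1 h6 with h7 | rfl
      · exact h3 r h5 h7
      · exact h4
  have h2 := measureReal_inter_add_sdiff (μ := μ) (s := A) (hX.measurableSet_favorable (m + 1))
  rw [hX.measureReal_inter_favorable hF
    (hX.measurableSet_firstReady_inter_unfavorableUpTo hF m k) Set.inter_subset_left] at h2
  have hd' : (0 : ℝ) ≤ 1 - 1 / d := by
    rw [sub_nonneg, div_le_one (by linarith)]; exact hd
  rw [h1, ← ofReal_measureReal (μ := μ) (s := A), ← ofReal_measureReal, ← ENNReal.ofReal_mul hd']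
  congr 1
  linear_combination h2

theorem measure_unfavorableUpTo [IsProbabilityMeasure μ]
    (hX : IsRandomExecution μ 𝓕 t F v d coin X a)
    (htn : 3 * t < n) (hF : F.card ≤ t) (hd : 1 ≤ d) (m : ℕ) :
    μ (unfavorableUpTo F coin X m) = ENNReal.ofReal (1 - 1 / d) ^ m := by
  induction m with
  | zero =>
    have : unfavorableUpTo F coin X 0 = Set.univ :=
      Set.eq_univ_of_forall fun ω r h1 h2 => by omega
    rw [this, measure_univ, pow_zero]
  | succ m ih => rw [hX.measure_unfavorableUpTo_succ htn hF hd, ih, pow_succ']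

/-- An upper bound for the last decision round. -/
theorem lastDecisionRound_le (hX : IsRandomExecution μ 𝓕 t F v d coin X a)
    (htn : 3 * t < n) (hF : F.card ≤ t) :
    ∀ᵐ ω ∂μ, lastDecisionRound F (fun k => X k ω) ≤
      1 + ∑' m, (unfavorableUpTo F coin X m).indicator 1 ω := by
  classical
  filter_upwards [hX.fair] with ω hω
  by_cases h : ∃ m, ω ∉ unfavorableUpTo F coin X m
  -- The minimum is positive because the condition on rounds 1, ..., 0 is void.
  · obtain ⟨m, hm⟩ : ∃ m, Nat.find h = m + 1 := by
      refine Nat.exists_eq_succ_of_ne_zero fun h0 => Nat.find_spec h ?_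
      rw [h0]
      exact fun r h1 h2 => by omega
    have h1 : ω ∉ unfavorableUpTo F coin X (m + 1) := hm ▸ Nat.find_spec h
    have h2 : ∀ j < m + 1, ω ∈ unfavorableUpTo F coin X j := fun j hj =>
      not_not.1 (Nat.find_min h (hm ▸ hj))
    have h3 : ∃ r, 1 ≤ r ∧ r ≤ m + 1 ∧ ω ∈ favorable F coin X r := by
      simpa [unfavorableUpTo] using h1
    obtain ⟨r, hr, hrm, k, hk, hcoin⟩ := h3
    have h4 : lastDecisionRound F (fun k => X k ω) ≤ 1 + ((m + 1 : ℕ) : ℝ≥0∞) := by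
      refine iSup₂_le fun i hi => ?_
      obtain ⟨k', r', b, hb, hr'⟩ :=
        (hX.execution ω).decision_of_candidate htn hF hω hr hk.1 hcoin hi
      refine (decisionRound_le hb).trans ?_
      rw [← Nat.cast_one, ← Nat.cast_add]
      exact Nat.cast_le.2 (by omega)
    refine h4.trans (add_le_add le_rfl ?_)
    -- The indicators with indices 0, ..., m all equal 1, so the sum is at least m + 1.
    refine le_trans (le_of_eq ?_) (ENNReal.sum_le_tsum (Finset.range (m + 1)))
    rw [Finset.sum_congr rfl fun j hj =>
      Set.indicator_of_mem (h2 j (Finset.mem_range.1 hj)) (1 : Ω → ℝ≥0∞)]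
    simp
  -- Without a favorable round all indicators are 1 and the bound is infinite.
  · push Not at h
    have : ∑' m, (unfavorableUpTo F coin X m).indicator (1 : Ω → ℝ≥0∞) ω = ⊤ := by
      simp [Set.indicator_of_mem (h _)]
    simp [this]

/-- The geometric series with ratio 1 - 1/d has sum d. -/
theorem lintegral_bound [IsProbabilityMeasure μ] (hX : IsRandomExecution μ 𝓕 t F v d coin X a)
    (htn : 3 * t < n) (hF : F.card ≤ t) (hd : 1 ≤ d) :
    ∫⁻ ω, 1 + ∑' m, (unfavorableUpTo F coin X m).indicator 1 ω ∂μ = ENNReal.ofReal (d + 1) := by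
  have h0 : 0 < d := by linarith
  have hd' : (0 : ℝ) ≤ 1 - 1 / d := by
    rw [sub_nonneg, div_le_one h0]; exact hd
  rw [lintegral_add_left measurable_const, lintegral_tsum fun m =>
    (measurable_one.indicator (hX.measurableSet_unfavorableUpTo m)).aemeasurable]
  simp only [lintegral_const, measure_univ, mul_one,
    lintegral_indicator_one (hX.measurableSet_unfavorableUpTo _),
    hX.measure_unfavorableUpTo htn hF hd, ENNReal.tsum_geometric]
  rw [← ENNReal.ofReal_one, ← ENNReal.ofReal_sub _ hd', sub_sub_cancel, one_div,
    ENNReal.ofReal_inv_of_pos h0, inv_inv, ← ENNReal.ofReal_add zero_le_one h0.le, add_comm]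

end IsRandomExecution

end

end BBC

theorem mainTheorem1 {n t : ℕ} (htn : 3 * t < n)
    (F : Finset (Fin n)) (hF : F.card ≤ t)
    (d : ℝ) (hd : 2 ≤ d)
    (v : Fin n → Bool)
    {Ω : Type*} [MeasurableSpace Ω] (μ : Measure Ω) [IsProbabilityMeasure μ]
    (𝓕 : Filtration ℕ (inferInstance : MeasurableSpace Ω))
    (coin : Ω → ℕ → Fin n → Bool)
    (X : ℕ → Ω → BBC.Config n) (a : ℕ → Ω → BBC.Action n)
    (hX : BBC.IsRandomExecution μ 𝓕 t F v d coin X a) :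
    (∀ᵐ ω ∂μ, BBC.BBCTermination F (fun k => X k ω)) ∧
    (∀ ω, BBC.BBCAgreement F (fun k => X k ω)) ∧
    (∀ ω, BBC.BBCValidity F v (fun k => X k ω)) ∧
    ∫⁻ ω, BBC.lastDecisionRound F (fun k => X k ω) ∂μ ≤ ENNReal.ofReal (d + 1) := by
  have hle := hX.lastDecisionRound_le htn hF
  have hint := hX.lintegral_bound htn hF (by linarith)
  refine ⟨?_, fun ω i hi j hj b b' hb hb' => ?_, fun ω b hv i hi b' hb' => ?_,
    (lintegral_mono_ae hle).trans hint.le⟩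
  -- The bound has finite integral, hence is finite almost everywhere, and a finite decision round
  -- means that a decision is made. Measurability is checked for the bound only; that of
  -- `lastDecisionRound` is never used.
  · have hmeas : Measurable fun ω =>
        1 + ∑' m, (BBC.unfavorableUpTo F coin X m).indicator (1 : Ω → ℝ≥0∞) ω :=
      (Measurable.tsum fun m =>
        measurable_one.indicator (hX.measurableSet_unfavorableUpTo m)).const_add 1
    filter_upwards [hle, ae_lt_top hmeas (hint ▸ ENNReal.ofReal_ne_top)] with ω h1 h2 i hi
    exact BBC.exists_decides_of_decisionRound_lt_top
      ((le_iSup₂ (f := fun i (_ : i ∉ F) => BBC.decisionRound (fun k => X k ω) i) i hi).trans_lt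
        (h1.trans_lt h2))
  · have h := hX.execution ω
    obtain ⟨k, r, hk⟩ := hb
    obtain ⟨k', r', hk'⟩ := hb'
    -- Decisions are permanent, so both are visible in one common configuration.
    exact (h.globalInv hF (max k k')).agreement htn hF hi hj
      ((h.extends hF (le_max_left k k') i).decision _ hk)
      ((h.extends hF (le_max_right k k') j).decision _ hk')
  · obtain ⟨k, r, hk⟩ := hb'
    exact ((hX.execution ω).globalInv hF k).validity htn hF hv hi hk
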